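/- Let $\mathbb P=\mathbb C\cup\{\infty\}$ be the Riemann sphere with the spherical distance $\sigma(z,w)=\frac{2|z-w|}{\sqrt{(1+|z|^2)(1+|w|^2)}}$ for $z,w\in\mathbb C$, $\sigma(z,\infty)=\sigma(\infty,z)=\frac{2}{\sqrt{1+|z|^2}}$ for $z\in\mathbb C$, and $\sigma(\infty,\infty)=0$. Let $v\in\mathbb C$, let $W\subset\mathbb C$ be a closed neighbourhood of $v$, and let $g:W\setminus\{v\}\to\mathbb P$ be a holomorphic map with an essential singularity at $v$ (that is, $g(z)$ has no limit in $\mathbb P$ as $z\to v$). Then at least one of the following holds. (a) There are a sequence $v_n\to v$ in $\mathbb C$, a sequence of real numbers $r_n>0$ with $r_n\to 0$, and a non-constant holomorphic map $h:\mathbb C\to\mathbb P$ such that, for every compact $K\subset\mathbb C$, one has $v_n+r_nz\in W\setminus\{v\}$ for all $z\in K$ once $n$ is large enough, and $g(v_n+r_nz)\to h(z)$ uniformly in $z\in K$ with respect to $\sigma$. (b) There are $\zeta\in\mathbb C$, a sequence $v_n\to v$ in $\mathbb C$, a sequence of real numbers $r_n>0$ with $r_n\to 0$, and a non-constant holomorphic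 map $h:\mathbb C\setminus\{\zeta\}\to\mathbb P$ such that, for every compact $K\subset\mathbb C\setminus\{\zeta\}$, one has $v_n+r_nz\in W\setminus\{v\}$ for all $z\in K$ once $n$ is large enough, and $g(v_n+r_nz)\to h(z)$ uniformly in $z\in K$ with respect to $\sigma$. -/

import Mathlib

open Filter Topology

namespace SphereValued

/-- The affine chart of the Riemann sphere `OnePoint ℂ`, defined off `∞` (with a dummy value there). -/
noncomputable def chartZero : OnePoint ℂ → ℂ
  | OnePoint.infty => 0
  | OnePoint.some z => z

/-- The chart `w ↦ 1 / w` of the Riemann sphere, sending `∞` to `0`, defined off the point `0`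
(with a dummy value there). -/
noncomputable def chartInfty : OnePoint ℂ → ℂ
  | OnePoint.infty => 0
  | OnePoint.some z => z⁻¹

/-- The spherical distance: the Euclidean distance of the stereographic projections to the unit
sphere. -/
noncomputable def sphericalDist : OnePoint ℂ → OnePoint ℂ → ℝ
  | OnePoint.infty, OnePoint.infty => 0
  | OnePoint.infty, OnePoint.some w => 2 / Real.sqrt (1 + ‖w‖ ^ 2)
  | OnePoint.some z, OnePoint.infty => 2 / Real.sqrt (1 + ‖z‖ ^ 2)
  | OnePoint.some z, OnePoint.some w =>
      2 * ‖z - w‖ / Real.sqrt ((1 + ‖z‖ ^ 2) * (1 + ‖w‖ ^ 2))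

/-- `f` is a holomorphic map on `S` with values in the Riemann sphere: it is continuous on `S` and
complex differentiable when read in the charts of the sphere. -/
def HolomorphicOn (f : ℂ → OnePoint ℂ) (S : Set ℂ) : Prop :=
  ∀ x ∈ S, ContinuousWithinAt f S x ∧
    (f x ≠ OnePoint.infty → DifferentiableWithinAt ℂ (fun z => chartZero (f z)) S x) ∧
    (f x ≠ OnePoint.some 0 → DifferentiableWithinAt ℂ (fun z => chartInfty (f z)) S x)

/-- For a sphere-valued map `g`, holomorphic on a punctured neighbourhood of `v`: the isolated
singularity `v` is essential, that is, neither removable nor a pole; `g` has no limit in the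
Riemann sphere at `v`. -/
def HasEssentialSingularityAt (g : ℂ → OnePoint ℂ) (v : ℂ) : Prop :=
  ¬ ∃ c : OnePoint ℂ, Tendsto g (𝓝[≠] v) (𝓝 c)

/-- `f` is constant on `D`. -/
def IsConstantOn (f : ℂ → OnePoint ℂ) (D : Set ℂ) : Prop :=
  ∃ c : OnePoint ℂ, ∀ z ∈ D, f z = c

/-- For every compact `K ⊆ D`, the map `z ↦ g (v n + r n * z)`, where `g` is a map defined on `S`,
is well defined on `K` for all large `n`, and converges to `h` uniformly on `K` for the spherical
distance. -/
def RescalingsConverge (g : ℂ → OnePoint ℂ) (S : Set ℂ) (v : ℕ → ℂ) (r : ℕ → ℝ)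
    (h : ℂ → OnePoint ℂ) (D : Set ℂ) : Prop :=
  ∀ K : Set ℂ, K ⊆ D → IsCompact K →
    (∀ᶠ n in atTop, ∀ z ∈ K, v n + (r n : ℂ) * z ∈ S) ∧
    ∀ ε : ℝ, 0 < ε →
      ∀ᶠ n in atTop, ∀ z ∈ K, sphericalDist (g (v n + (r n : ℂ) * z)) (h z) < ε

end SphereValued

/-!
The argument compares the spherical derivative `g^#` of `g` (`sphericalDeriv`) with `1 / ‖z - v‖`
near `v`.

If `‖z - v‖ * g^# z` is unbounded near `v`, Zalcman's renormalisation applies: on discs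
`D (zₙ, ‖zₙ - v‖ / 2)` with `‖zₙ - v‖ * g^# zₙ → ∞` one maximises the product of `g^#` and the
distance to the boundary of the disc (`exists_rescaling`). Rescaling at the maximum `pₙ` by
`rₙ = 1 / g^# pₙ` gives maps on discs of radius tending to `∞`, with spherical derivative `1` at
`0`, and at most `2` on the concentric discs of half the radius. By Marty's theorem (`exists_subseq_of_sphericalDeriv_le`) a
subsequence converges locally uniformly on the plane, and by Cauchy's estimate
(`exists_sphericalDeriv_lt_one`) the limit is not constant. This is the first alternative.

If `‖z - v‖ * g^# z` is bounded near `v`, then for all scales `rₙ → 0` the maps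
`z ↦ g (v + rₙ z)` have locally bounded spherical derivatives on the punctured plane, so Marty's
theorem gives limits there. If all of these were constant, the images under `g` of the circles about
`v` would shrink to points as the radius tends to `0`. That is impossible at an essential
singularity (`exists_tendsto_of_oscillation`): `g` would have two cluster points at `v`, one of them
a finite point `a`, and there would be annuli about `v` on which `g` keeps away from `a`, while the
boundary circles have images concentrated near two points close to `a` and some circle inside has
its image at least about twice as far from `a`. For a coordinate `F` with pole at `a`, the product
`(F ∘ g - c₁) (F ∘ g - c₂)`, with `cᵢ` the approximate values of `F ∘ g` on the boundary circles, is
small on the boundary but not inside, against the maximum principle.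

The spherical metric is handled through the isometric embedding `toSphere` into a Euclidean space,
and the point `∞` through the isometry `inversion`.
-/

namespace SphereValued

/-! ### The spherical metric -/

/-- The inversion `z ↦ 1 / z` of the Riemann sphere. -/
noncomputable def inversion : OnePoint ℂ → OnePoint ℂ
  | OnePoint.infty => OnePoint.some 0
  | OnePoint.some z => if z = 0 then OnePoint.infty else OnePoint.some z⁻¹

/-- Inverse stereographic projection, onto the unit sphere of `ℂ × ℝ` with its Euclidean norm. -/
noncomputable def toSphere : OnePoint ℂ → WithLp 2 (ℂ × ℝ)
  | OnePoint.infty => WithLp.toLp 2 (0, 1)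
  | OnePoint.some z =>
      WithLp.toLp 2 (((2 / (1 + ‖z‖ ^ 2) : ℝ) : ℂ) * z, (‖z‖ ^ 2 - 1) / (1 + ‖z‖ ^ 2))

lemma sphericalDist_nonneg (a b : OnePoint ℂ) : 0 ≤ sphericalDist a b := by
  rcases a with _ | z <;> rcases b with _ | w
  · exact le_rfl
  · change 0 ≤ 2 / Real.sqrt (1 + ‖w‖ ^ 2); positivity
  · change 0 ≤ 2 / Real.sqrt (1 + ‖z‖ ^ 2); positivity
  · change 0 ≤ 2 * ‖z - w‖ / Real.sqrt ((1 + ‖z‖ ^ 2) * (1 + ‖w‖ ^ 2)); positivity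

lemma sphericalDist_comm (a b : OnePoint ℂ) : sphericalDist a b = sphericalDist b a := by
  rcases a with _ | z <;> rcases b with _ | w
  · rfl
  · rfl
  · rfl
  · change 2 * ‖z - w‖ / Real.sqrt ((1 + ‖z‖ ^ 2) * (1 + ‖w‖ ^ 2)) =
      2 * ‖w - z‖ / Real.sqrt ((1 + ‖w‖ ^ 2) * (1 + ‖z‖ ^ 2))
    rw [norm_sub_rev, mul_comm (1 + ‖z‖ ^ 2)]

lemma sphericalDist_coe_coe (z w : ℂ) : sphericalDist (z : OnePoint ℂ) (w : OnePoint ℂ) =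
    2 * ‖z - w‖ / (Real.sqrt (1 + ‖z‖ ^ 2) * Real.sqrt (1 + ‖w‖ ^ 2)) := by
  rw [← Real.sqrt_mul (by positivity)]; rfl

lemma sphericalDist_coe_infty (z : ℂ) : sphericalDist (z : OnePoint ℂ) OnePoint.infty =
    2 / Real.sqrt (1 + ‖z‖ ^ 2) := rfl

/-- The spherical distance is the chordal distance. -/
lemma dist_toSphere (a b : OnePoint ℂ) :
    dist (toSphere a) (toSphere b) = sphericalDist a b := by
  have key : ∀ z : ℂ, dist (toSphere (z : OnePoint ℂ)) (toSphere OnePoint.infty) =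
      sphericalDist (z : OnePoint ℂ) OnePoint.infty := by
    intro z
    rw [sphericalDist_coe_infty, ← sq_eq_sq₀ dist_nonneg (by positivity), dist_eq_norm,
      WithLp.prod_norm_sq_eq_of_L2, div_pow, Real.sq_sqrt (by positivity)]
    simp only [toSphere, WithLp.sub_fst, WithLp.sub_snd, WithLp.toLp_fst, WithLp.toLp_snd, sub_zero,
      norm_mul, Complex.norm_real,
      mul_pow, Real.norm_eq_abs, sq_abs]
    have : (1 + ‖z‖ ^ 2) ≠ 0 := by positivity
    field_simp
    ring
  rcases a with _ | z <;> rcases b with _ | w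
  · exact dist_self _
  · exact (dist_comm _ _).trans ((key w).trans (sphericalDist_comm _ _))
  · exact key z
  · change dist (toSphere (z : OnePoint ℂ)) (toSphere (w : OnePoint ℂ)) =
      sphericalDist (z : OnePoint ℂ) (w : OnePoint ℂ)
    rw [sphericalDist_coe_coe, ← sq_eq_sq₀ dist_nonneg (by positivity), dist_eq_norm,
      WithLp.prod_norm_sq_eq_of_L2, div_pow, mul_pow, mul_pow, Real.sq_sqrt (by positivity),
      Real.sq_sqrt (by positivity)]
    simp only [toSphere, WithLp.sub_fst, WithLp.sub_snd, WithLp.toLp_fst, WithLp.toLp_snd,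
      Real.norm_eq_abs, sq_abs]
    have h1 : (1 + (z.re * z.re + z.im * z.im)) ≠ 0 := by
      have := mul_self_nonneg z.re; have := mul_self_nonneg z.im; positivity
    have h2 : (1 + (w.re * w.re + w.im * w.im)) ≠ 0 := by
      have := mul_self_nonneg w.re; have := mul_self_nonneg w.im; positivity
    simp only [← Complex.normSq_eq_norm_sq, Complex.normSq_apply, Complex.sub_re, Complex.sub_im,
      Complex.re_ofReal_mul, Complex.im_ofReal_mul]
    field_simp
    ring

lemma sphericalDist_triangle (a b c : OnePoint ℂ) :
    sphericalDist a c ≤ sphericalDist a b + sphericalDist b c := by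
  simpa only [dist_toSphere] using dist_triangle (toSphere a) (toSphere b) (toSphere c)

lemma eq_of_sphericalDist_eq_zero {a b : OnePoint ℂ} (h : sphericalDist a b = 0) : a = b := by
  have key : ∀ z : ℂ, sphericalDist (z : OnePoint ℂ) OnePoint.infty ≠ 0 := by
    intro z
    rw [sphericalDist_coe_infty]
    positivity
  rcases a with _ | z <;> rcases b with _ | w
  · rfl
  · exact absurd ((sphericalDist_comm _ _).trans h) (key w)
  · exact absurd h (key z)
  · change sphericalDist (z : OnePoint ℂ) (w : OnePoint ℂ) = 0 at h
    rw [sphericalDist_coe_coe, div_eq_zero_iff] at h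
    rcases h with h | h
    · have : z - w = 0 := by simpa using h
      rw [sub_eq_zero.1 this]
    · exact absurd h (by positivity)

lemma sphericalDist_self (a : OnePoint ℂ) : sphericalDist a a = 0 := by
  rw [← dist_toSphere, dist_self]

lemma toSphere_injective : Function.Injective toSphere := fun a b h =>
  eq_of_sphericalDist_eq_zero (by rw [← dist_toSphere, h, dist_self])

lemma continuous_toSphere : Continuous toSphere := by
  rw [OnePoint.continuous_iff]
  constructor
  · rw [tendsto_iff_dist_tendsto_zero, coclosedCompact_eq_cocompact]
    simp only [dist_toSphere]
    have h : Tendsto (fun z : ℂ => Real.sqrt (1 + ‖z‖ ^ 2)) (cocompact ℂ) atTop :=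
      Real.tendsto_sqrt_atTop.comp (tendsto_atTop_add_const_left _ _
        ((tendsto_pow_atTop two_ne_zero).comp (tendsto_norm_cocompact_atTop (E := ℂ))))
    exact h.const_div_atTop 2
  · refine (LipschitzWith.of_dist_le_mul (K := 2) fun z w => ?_).continuous
    rw [dist_toSphere, sphericalDist_coe_coe, dist_eq_norm]
    refine div_le_self (by positivity) (one_le_mul_of_one_le_of_one_le ?_ ?_) <;>
    exact Real.one_le_sqrt.2 (le_add_of_nonneg_right (by positivity))

lemma isClosedEmbedding_toSphere : IsClosedEmbedding toSphere :=
  continuous_toSphere.isClosedEmbedding toSphere_injective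

lemma tendsto_nhds_iff_sphericalDist {α : Type*} {l : Filter α} {u : α → OnePoint ℂ}
    {c : OnePoint ℂ} :
    Tendsto u l (𝓝 c) ↔ Tendsto (fun x => sphericalDist (u x) c) l (𝓝 0) := by
  rw [isClosedEmbedding_toSphere.isInducing.tendsto_nhds_iff, tendsto_iff_dist_tendsto_zero]
  simp only [Function.comp_apply, dist_toSphere]

lemma continuous_sphericalDist : Continuous fun p : OnePoint ℂ × OnePoint ℂ =>
    sphericalDist p.1 p.2 := by
  simp only [← dist_toSphere]
  exact (continuous_toSphere.comp continuous_fst).dist (continuous_toSphere.comp continuous_snd)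

lemma inversion_coe {z : ℂ} (hz : z ≠ 0) : inversion (z : OnePoint ℂ) = (z⁻¹ : ℂ) :=
  if_neg hz

lemma inversion_zero : inversion ((0 : ℂ) : OnePoint ℂ) = OnePoint.infty := if_pos rfl

lemma inversion_inversion (a : OnePoint ℂ) : inversion (inversion a) = a := by
  rcases a with _ | z
  · exact inversion_zero
  · change inversion (inversion (z : OnePoint ℂ)) = (z : OnePoint ℂ)
    by_cases hz : z = 0
    · rw [hz, inversion_zero]; rfl
    · rw [inversion_coe hz, inversion_coe (inv_ne_zero hz), inv_inv]

lemma sphericalDist_inversion (a b : OnePoint ℂ) :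
    sphericalDist (inversion a) (inversion b) = sphericalDist a b := by
  have hs : ∀ z : ℂ, z ≠ 0 → Real.sqrt (1 + ‖z⁻¹‖ ^ 2) = Real.sqrt (1 + ‖z‖ ^ 2) / ‖z‖ := by
    intro z hz
    have h0 : ‖z‖ ≠ 0 := norm_ne_zero_iff.2 hz
    rw [← Real.sqrt_sq (norm_nonneg z), ← Real.sqrt_div (by positivity),
      Real.sqrt_sq (norm_nonneg z), norm_inv]
    congr 1
    field_simp
    ring
  have key : ∀ z : ℂ, sphericalDist (inversion (z : OnePoint ℂ)) (inversion OnePoint.infty) =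
      sphericalDist (z : OnePoint ℂ) OnePoint.infty := by
    intro z
    change sphericalDist (inversion (z : OnePoint ℂ)) ((0 : ℂ) : OnePoint ℂ) = _
    by_cases hz : z = 0
    · rw [hz, inversion_zero, sphericalDist_comm]
    · have h0 : ‖z‖ ≠ 0 := norm_ne_zero_iff.2 hz
      rw [inversion_coe hz, sphericalDist_coe_coe, sphericalDist_coe_infty, hs z hz]
      have : Real.sqrt (1 + ‖z‖ ^ 2) ≠ 0 := by positivity
      simp
      field_simp
  have key0 : ∀ z : ℂ, sphericalDist (inversion (z : OnePoint ℂ)) (inversion (0 : ℂ)) =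
      sphericalDist (z : OnePoint ℂ) (0 : ℂ) := by
    intro z
    have := key z
    by_cases hz : z = 0
    · rw [hz, sphericalDist_self, sphericalDist_self]
    · have h0 : ‖z‖ ≠ 0 := norm_ne_zero_iff.2 hz
      rw [inversion_zero, inversion_coe hz, sphericalDist_coe_coe, sphericalDist_coe_infty, hs z hz]
      have : Real.sqrt (1 + ‖z‖ ^ 2) ≠ 0 := by positivity
      simp
      field_simp
  rcases a with _ | z <;> rcases b with _ | w
  · change sphericalDist (inversion OnePoint.infty) (inversion OnePoint.infty) =
      sphericalDist OnePoint.infty OnePoint.infty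
    rw [sphericalDist_self, sphericalDist_self]
  · exact (sphericalDist_comm _ _).trans ((key w).trans (sphericalDist_comm _ _))
  · exact key z
  · change sphericalDist (inversion (z : OnePoint ℂ)) (inversion (w : OnePoint ℂ)) =
      sphericalDist (z : OnePoint ℂ) (w : OnePoint ℂ)
    by_cases hw : w = 0
    · rw [hw]; exact key0 z
    by_cases hz : z = 0
    · rw [hz, sphericalDist_comm, key0, sphericalDist_comm]
    have h0 : ‖z‖ ≠ 0 := norm_ne_zero_iff.2 hz
    have h1 : ‖w‖ ≠ 0 := norm_ne_zero_iff.2 hw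
    rw [inversion_coe hz, inversion_coe hw, sphericalDist_coe_coe, sphericalDist_coe_coe, hs z hz,
      hs w hw, inv_sub_inv hz hw, norm_div, norm_mul, norm_sub_rev]
    have : Real.sqrt (1 + ‖z‖ ^ 2) ≠ 0 := by positivity
    have : Real.sqrt (1 + ‖w‖ ^ 2) ≠ 0 := by positivity
    field_simp

lemma continuous_inversion : Continuous inversion := by
  rw [continuous_iff_continuousAt]
  intro a
  rw [ContinuousAt, tendsto_nhds_iff_sphericalDist]
  simp only [sphericalDist_inversion]
  exact tendsto_nhds_iff_sphericalDist.1 tendsto_id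

lemma chartZero_inversion (a : OnePoint ℂ) : chartZero (inversion a) = chartInfty a := by
  rcases a with _ | z
  · rfl
  · change chartZero (inversion (z : OnePoint ℂ)) = z⁻¹
    by_cases hz : z = 0
    · rw [hz, inversion_zero, inv_zero]; rfl
    · rw [inversion_coe hz]; rfl

lemma chartInfty_inversion (a : OnePoint ℂ) : chartInfty (inversion a) = chartZero a := by
  rw [← chartZero_inversion, inversion_inversion]

lemma inversion_eq_infty {a : OnePoint ℂ} :
    inversion a = OnePoint.infty ↔ a = ((0 : ℂ) : OnePoint ℂ) :=
  ⟨fun h => by rw [← inversion_inversion a, h]; rfl, fun h => by rw [h, inversion_zero]⟩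

lemma inversion_eq_zero {a : OnePoint ℂ} :
    inversion a = ((0 : ℂ) : OnePoint ℂ) ↔ a = OnePoint.infty :=
  ⟨fun h => by rw [← inversion_inversion a, h, inversion_zero], fun h => by rw [h]; rfl⟩

lemma coe_chartZero {a : OnePoint ℂ} (ha : a ≠ OnePoint.infty) :
    (chartZero a : OnePoint ℂ) = a := by
  rcases a with _ | z
  · exact absurd rfl ha
  · rfl

/-- Near a finite point `w` the affine chart is Lipschitz for the spherical distance. -/
lemma ne_infty_and_norm_chartZero_sub_le {a b : OnePoint ℂ} (hb : b ≠ OnePoint.infty)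
    (h : sphericalDist a b ≤ 1 / Real.sqrt (1 + ‖chartZero b‖ ^ 2)) :
    a ≠ OnePoint.infty ∧
      ‖chartZero a - chartZero b‖ ≤ (1 + ‖chartZero b‖ ^ 2) * sphericalDist a b := by
  obtain ⟨w, rfl⟩ := OnePoint.ne_infty_iff_exists.1 hb
  change sphericalDist a (w : OnePoint ℂ) ≤ 1 / Real.sqrt (1 + ‖w‖ ^ 2) at h
  change _ ∧ ‖chartZero a - w‖ ≤ (1 + ‖w‖ ^ 2) * sphericalDist a (w : OnePoint ℂ)
  have hS : 0 < Real.sqrt (1 + ‖w‖ ^ 2) := by positivity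
  have hS2 : Real.sqrt (1 + ‖w‖ ^ 2) ^ 2 = 1 + ‖w‖ ^ 2 := Real.sq_sqrt (by positivity)
  have htri := sphericalDist_triangle (w : OnePoint ℂ) a OnePoint.infty
  rw [sphericalDist_coe_infty, sphericalDist_comm _ a] at htri
  have h2 : 2 / Real.sqrt (1 + ‖w‖ ^ 2) = 2 * (1 / Real.sqrt (1 + ‖w‖ ^ 2)) := by ring
  have h3 : 0 < 1 / Real.sqrt (1 + ‖w‖ ^ 2) := by positivity
  have ha : a ≠ OnePoint.infty := by
    rintro rfl
    rw [sphericalDist_self] at htri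
    linarith
  refine ⟨ha, ?_⟩
  obtain ⟨z, rfl⟩ := OnePoint.ne_infty_iff_exists.1 ha
  change ‖z - w‖ ≤ _
  rw [sphericalDist_coe_infty] at htri
  have hT : 0 < Real.sqrt (1 + ‖z‖ ^ 2) := by positivity
  have h4 : 1 / Real.sqrt (1 + ‖w‖ ^ 2) ≤ 2 / Real.sqrt (1 + ‖z‖ ^ 2) := by linarith
  rw [div_le_div_iff₀ hS hT, one_mul] at h4
  rw [sphericalDist_coe_coe, ← mul_div_assoc, le_div_iff₀ (by positivity)]
  generalize Real.sqrt (1 + ‖z‖ ^ 2) = T at *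
  generalize Real.sqrt (1 + ‖w‖ ^ 2) = S at *
  rw [← hS2]
  have := mul_le_mul_of_nonneg_left h4 (show 0 ≤ ‖z - w‖ * S by positivity)
  nlinarith

/-! ### Holomorphic maps to the sphere and the spherical derivative -/

/-- Holomorphy of a sphere-valued map at a single point: continuity there, and complex
differentiability there in the charts of the sphere. -/
def HolomorphicAt (f : ℂ → OnePoint ℂ) (x : ℂ) : Prop :=
  ContinuousAt f x ∧
    (f x ≠ OnePoint.infty → DifferentiableAt ℂ (fun z => chartZero (f z)) x) ∧
    (f x ≠ OnePoint.some 0 → DifferentiableAt ℂ (fun z => chartInfty (f z)) x)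

lemma holomorphicOn_iff_of_isOpen {f : ℂ → OnePoint ℂ} {U : Set ℂ} (hU : IsOpen U) :
    HolomorphicOn f U ↔ ∀ x ∈ U, HolomorphicAt f x := by
  refine forall₂_congr fun x hx => ?_
  have hx' := hU.mem_nhds hx
  have hd : ∀ F : ℂ → ℂ, DifferentiableWithinAt ℂ F U x ↔ DifferentiableAt ℂ F x := fun F =>
    ⟨fun h => h.differentiableAt hx', fun h => h.differentiableWithinAt⟩
  rw [HolomorphicAt, continuousWithinAt_iff_continuousAt hx', hd, hd]

lemma HolomorphicOn.mono {f : ℂ → OnePoint ℂ} {S T : Set ℂ} (hf : HolomorphicOn f S)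
    (hT : T ⊆ S) : HolomorphicOn f T := fun x hx =>
  ⟨(hf x (hT hx)).1.mono hT, fun h => ((hf x (hT hx)).2.1 h).mono hT,
    fun h => ((hf x (hT hx)).2.2 h).mono hT⟩

lemma HolomorphicAt.inversion {f : ℂ → OnePoint ℂ} {x : ℂ} (hf : HolomorphicAt f x) :
    HolomorphicAt (fun z => inversion (f z)) x := by
  refine ⟨continuous_inversion.continuousAt.comp hf.1, fun h => ?_, fun h => ?_⟩
  · simp only [chartZero_inversion]
    exact hf.2.2 fun h' => h (inversion_eq_infty.2 h')
  · simp only [chartInfty_inversion]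
    exact hf.2.1 fun h' => h (inversion_eq_zero.2 h')

lemma HolomorphicAt.comp_affine {f : ℂ → OnePoint ℂ} {p r z : ℂ}
    (hf : HolomorphicAt f (p + r * z)) : HolomorphicAt (fun z => f (p + r * z)) z := by
  have hd : DifferentiableAt ℂ (fun z : ℂ => p + r * z) z := by fun_prop
  exact ⟨ContinuousAt.comp (f := fun z : ℂ => p + r * z) hf.1 hd.continuousAt,
    fun h => DifferentiableAt.comp (f := fun z : ℂ => p + r * z) z (hf.2.1 h) hd,
    fun h => DifferentiableAt.comp (f := fun z : ℂ => p + r * z) z (hf.2.2 h) hd⟩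

/-- The spherical derivative of a sphere-valued map: the limit at `x` of the ratio of the spherical
to the Euclidean distance. -/
noncomputable def sphericalDeriv (f : ℂ → OnePoint ℂ) (x : ℂ) : ℝ :=
  limUnder (𝓝[≠] x) fun w => sphericalDist (f w) (f x) / ‖w - x‖

lemma HolomorphicAt.tendsto_slope_chartZero {f : ℂ → OnePoint ℂ} {x : ℂ} (hf : HolomorphicAt f x)
    (hx : f x ≠ OnePoint.infty) :
    Tendsto (fun w => sphericalDist (f w) (f x) / ‖w - x‖) (𝓝[≠] x)
      (𝓝 (2 * ‖deriv (fun z => chartZero (f z)) x‖ / (1 + ‖chartZero (f x)‖ ^ 2))) := by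
  have hd := hf.2.1 hx
  set F : ℂ → ℂ := fun z => chartZero (f z) with hF
  have h1 : Tendsto (fun w => ‖slope F x w‖) (𝓝[≠] x) (𝓝 ‖deriv F x‖) :=
    (hasDerivAt_iff_tendsto_slope.1 hd.hasDerivAt).norm
  have h2 : Tendsto (fun w => Real.sqrt (1 + ‖F w‖ ^ 2)) (𝓝[≠] x)
      (𝓝 (Real.sqrt (1 + ‖F x‖ ^ 2))) := by
    have : ContinuousAt (fun w => Real.sqrt (1 + ‖F w‖ ^ 2)) x := by
      have := hd.continuousAt
      fun_prop
    exact this.tendsto.mono_left nhdsWithin_le_nhds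
  have h3 := (h1.const_mul 2).div (h2.mul_const (Real.sqrt (1 + ‖F x‖ ^ 2))) (by positivity)
  rw [Real.mul_self_sqrt (by positivity)] at h3
  refine h3.congr' ?_
  have hne : ∀ᶠ w in 𝓝[≠] x, f w ≠ OnePoint.infty :=
    (hf.1.eventually_ne hx).filter_mono nhdsWithin_le_nhds
  filter_upwards [hne, self_mem_nhdsWithin] with w hw hwx
  have hwx' : ‖w - x‖ ≠ 0 := norm_ne_zero_iff.2 (sub_ne_zero.2 hwx)
  conv_rhs => rw [← coe_chartZero hw, ← coe_chartZero hx, sphericalDist_coe_coe]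
  change 2 * ‖slope F x w‖ / _ = 2 * ‖F w - F x‖ / (Real.sqrt (1 + ‖F w‖ ^ 2) *
    Real.sqrt (1 + ‖F x‖ ^ 2)) / ‖w - x‖
  rw [slope_def_field, norm_div]
  field_simp

lemma HolomorphicAt.sphericalDeriv_eq {f : ℂ → OnePoint ℂ} {x : ℂ} (hf : HolomorphicAt f x)
    (hx : f x ≠ OnePoint.infty) : sphericalDeriv f x =
      2 * ‖deriv (fun z => chartZero (f z)) x‖ / (1 + ‖chartZero (f x)‖ ^ 2) :=
  (hf.tendsto_slope_chartZero hx).limUnder_eq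

lemma sphericalDeriv_inversion (f : ℂ → OnePoint ℂ) (x : ℂ) :
    sphericalDeriv (fun z => SphereValued.inversion (f z)) x = sphericalDeriv f x := by
  simp only [sphericalDeriv, sphericalDist_inversion]

lemma HolomorphicAt.tendsto_sphericalDeriv {f : ℂ → OnePoint ℂ} {x : ℂ} (hf : HolomorphicAt f x) :
    Tendsto (fun w => sphericalDist (f w) (f x) / ‖w - x‖) (𝓝[≠] x)
      (𝓝 (sphericalDeriv f x)) := by
  by_cases hx : f x = OnePoint.infty
  · have h0 : SphereValued.inversion (f x) ≠ OnePoint.infty := by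
      rw [hx]; exact OnePoint.coe_ne_infty 0
    have := hf.inversion.tendsto_slope_chartZero h0
    rw [← hf.inversion.sphericalDeriv_eq h0, sphericalDeriv_inversion] at this
    simpa only [sphericalDist_inversion] using this
  · rw [hf.sphericalDeriv_eq hx]
    exact hf.tendsto_slope_chartZero hx

lemma HolomorphicAt.sphericalDeriv_nonneg {f : ℂ → OnePoint ℂ} {x : ℂ} (hf : HolomorphicAt f x) :
    0 ≤ sphericalDeriv f x :=
  ge_of_tendsto' hf.tendsto_sphericalDeriv fun _ =>
    div_nonneg (sphericalDist_nonneg _ _) (norm_nonneg _)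

lemma HolomorphicOn.continuousOn_sphericalDeriv {f : ℂ → OnePoint ℂ} {U : Set ℂ} (hU : IsOpen U)
    (hf : HolomorphicOn f U) : ContinuousOn (sphericalDeriv f) U := by
  have key : ∀ g : ℂ → OnePoint ℂ, (∀ x ∈ U, HolomorphicAt g x) → ∀ x ∈ U,
      g x ≠ OnePoint.infty → ContinuousAt (sphericalDeriv g) x := by
    intro g hg x hx hgx
    set V : Set ℂ := U ∩ g ⁻¹' {OnePoint.infty}ᶜ with hVdef
    have hV : IsOpen V :=
      ContinuousOn.isOpen_inter_preimage (fun z hz => (hg z hz).1.continuousWithinAt) hU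
        isOpen_compl_singleton
    have hd : DifferentiableOn ℂ (fun z => chartZero (g z)) V := fun z hz =>
      ((hg z hz.1).2.1 hz.2).differentiableWithinAt
    have hc : ContinuousOn (fun z => 2 * ‖deriv (fun z => chartZero (g z)) z‖ /
        (1 + ‖chartZero (g z)‖ ^ 2)) V :=
      ((hd.deriv hV).continuousOn.norm.const_mul 2).div
        ((hd.continuousOn.norm.pow 2).const_add 1) fun z _ => by positivity
    exact (hc.congr fun z hz => (hg z hz.1).sphericalDeriv_eq hz.2).continuousAt
      (hV.mem_nhds ⟨hx, hgx⟩)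
  rw [holomorphicOn_iff_of_isOpen hU] at hf
  intro x hx
  refine ContinuousAt.continuousWithinAt ?_
  by_cases h : f x = OnePoint.infty
  · have := key _ (fun z hz => (hf z hz).inversion) x hx
      (by rw [h]; exact OnePoint.coe_ne_infty 0)
    rwa [funext (sphericalDeriv_inversion f)] at this
  · exact key f hf x hx h

lemma HolomorphicAt.sphericalDeriv_comp_affine {f : ℂ → OnePoint ℂ} {p z : ℂ} {r : ℝ} (hr : 0 < r)
    (hf : HolomorphicAt f (p + r * z)) :
    sphericalDeriv (fun z => f (p + r * z)) z = r * sphericalDeriv f (p + r * z) := by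
  refine Tendsto.limUnder_eq ?_
  have hr' : (r : ℂ) ≠ 0 := Complex.ofReal_ne_zero.2 hr.ne'
  have ht : Tendsto (fun w : ℂ => p + r * w) (𝓝[≠] z) (𝓝[≠] (p + r * z)) := by
    refine tendsto_nhdsWithin_iff.2 ⟨?_, ?_⟩
    · have : ContinuousAt (fun w : ℂ => p + r * w) z := by fun_prop
      exact this.tendsto.mono_left nhdsWithin_le_nhds
    · filter_upwards [self_mem_nhdsWithin] with w hw h
      exact hw (mul_left_cancel₀ hr' (add_left_cancel h))
  refine ((hf.tendsto_sphericalDeriv.comp ht).const_mul r).congr fun w => ?_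
  have : p + r * w - (p + r * z) = r * (w - z) := by ring
  simp only [Function.comp_apply]
  rw [this, norm_mul, Complex.norm_real, Real.norm_of_nonneg hr.le, ← mul_div_assoc,
    mul_div_mul_left _ _ hr.ne']

/-- Mean value inequality for the spherical derivative. -/
lemma sphericalDist_le_of_sphericalDeriv_le {f : ℂ → OnePoint ℂ} {s : Set ℂ} (hs : Convex ℝ s)
    (hf : ∀ x ∈ s, HolomorphicAt f x) {C : ℝ} (hC : ∀ x ∈ s, sphericalDeriv f x ≤ C) {z w : ℂ}
    (hz : z ∈ s) (hw : w ∈ s) : sphericalDist (f w) (f z) ≤ C * ‖w - z‖ := by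
  rcases eq_or_ne w z with rfl | hwz
  · simp [sphericalDist_self]
  have hwz' : 0 < ‖w - z‖ := norm_pos_iff.2 (sub_ne_zero.2 hwz)
  -- `t ↦ sphericalDist (f (γ t)) (f z)` need not be differentiable, but by the triangle inequality
  -- its right slopes are controlled by the spherical derivative
  set γ : ℝ → ℂ := fun t => z + t * (w - z) with hγ
  have hγc : Continuous γ := by fun_prop
  have hγs : ∀ t ∈ Set.Icc (0 : ℝ) 1, γ t ∈ s := fun t ht => by
    have := hs.add_smul_sub_mem hz hw ht
    simpa [hγ] using this
  have hγd : ∀ t u : ℝ, ‖γ t - γ u‖ = |t - u| * ‖w - z‖ := fun t u => by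
    have : γ t - γ u = ((t - u : ℝ) : ℂ) * (w - z) := by simp only [hγ]; push_cast; ring
    rw [this, norm_mul, Complex.norm_real, Real.norm_eq_abs]
  have hcont : ContinuousOn (fun t => sphericalDist (f (γ t)) (f z)) (Set.Icc 0 1) := by
    have h1 : ContinuousOn (fun t => f (γ t)) (Set.Icc 0 1) := fun t ht =>
      (ContinuousAt.comp (f := γ) (hf _ (hγs t ht)).1 hγc.continuousAt).continuousWithinAt
    exact continuous_sphericalDist.comp_continuousOn (h1.prodMk continuousOn_const)
  have := image_le_of_liminf_slope_right_le_deriv_boundary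
    (f := fun t => sphericalDist (f (γ t)) (f z)) (B := fun t => t * (C * ‖w - z‖))
    (B' := fun _ => C * ‖w - z‖) (a := 0) (b := 1) hcont (by simp [hγ, sphericalDist_self])
    (by fun_prop) (fun t _ => by
      simpa using ((hasDerivAt_id t).mul_const (C * ‖w - z‖)).hasDerivWithinAt) ?_
    (Set.right_mem_Icc.2 zero_le_one)
  · simpa [hγ] using this
  · intro t ht r hr
    have hts := hγs t ⟨ht.1, ht.2.le⟩
    have htend : Tendsto γ (𝓝[>] t) (𝓝[≠] (γ t)) := by
      refine tendsto_nhdsWithin_iff.2 ⟨hγc.continuousAt.tendsto.mono_left nhdsWithin_le_nhds, ?_⟩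
      filter_upwards [self_mem_nhdsWithin] with u hu h
      have h1 := hγd u t
      rw [h, sub_self, norm_zero] at h1
      have h2 : 0 < |u - t| * ‖w - z‖ := mul_pos (abs_pos.2 (sub_ne_zero.2 (ne_of_gt hu))) hwz'
      linarith
    have hlim := ((hf _ hts).tendsto_sphericalDeriv.comp htend).mul_const ‖w - z‖
    have hlt : sphericalDeriv f (γ t) * ‖w - z‖ < r :=
      (mul_le_mul_of_nonneg_right (hC _ hts) hwz'.le).trans_lt hr
    refine Eventually.frequently ?_
    filter_upwards [hlim.eventually_lt_const hlt, self_mem_nhdsWithin] with u hu hut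
    refine lt_of_le_of_lt ?_ hu
    have hut' : 0 < u - t := sub_pos.2 hut
    simp only [Function.comp_apply]
    rw [slope_def_field, hγd, abs_of_pos hut', div_mul_eq_mul_div,
      mul_div_mul_right _ _ hwz'.ne']
    gcongr
    linarith [sphericalDist_triangle (f (γ u)) (f (γ t)) (f z)]

/-! ### Normal families -/

/-- Arzelà–Ascoli for sphere-valued maps that are locally uniformly Lipschitz from some index on,
the index depending on the place. -/
lemma exists_subseq_tendstoLocallyUniformlyOn {D : Set ℂ} {f : ℕ → ℂ → OnePoint ℂ}
    (hL : ∀ x ∈ D, ∃ r > 0, ∃ C : ℝ, ∀ᶠ n in atTop, ∀ z ∈ Metric.ball x r,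
      ∀ w ∈ Metric.ball x r, sphericalDist (f n w) (f n z) ≤ C * ‖w - z‖) :
    ∃ ψ : ℕ → ℕ, StrictMono ψ ∧ ∃ h : ℂ → OnePoint ℂ,
      TendstoLocallyUniformlyOn (fun n z => toSphere (f (ψ n) z)) (fun z => toSphere (h z))
        atTop D := by
  have hK : IsCompact (Set.range toSphere) := isCompact_range continuous_toSphere
  -- Tychonoff along a countable dense set
  obtain ⟨L, -, ψ, hψ, hlim⟩ := (isCompact_univ_pi fun _ : ℕ => hK).tendsto_subseq
    (x := fun n k => toSphere (f n (TopologicalSpace.denseSeq ℂ k)))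
    (fun n k _ => Set.mem_range_self _)
  rw [tendsto_pi_nhds] at hlim
  have hLψ : ∀ x ∈ D, ∃ r > 0, ∃ C > 0, ∀ᶠ n in atTop, ∀ z ∈ Metric.ball x r,
      ∀ w ∈ Metric.ball x r,
        dist (toSphere (f (ψ n) w)) (toSphere (f (ψ n) z)) ≤ C * dist w z := by
    intro x hx
    obtain ⟨r, hr, C, hC⟩ := hL x hx
    refine ⟨r, hr, max C 1, by positivity, ?_⟩
    filter_upwards [hψ.tendsto_atTop.eventually hC] with n hn z hz w hw
    rw [dist_toSphere, dist_eq_norm]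
    exact (hn z hz w hw).trans (mul_le_mul_of_nonneg_right (le_max_left _ _) (norm_nonneg _))
  have hconv : ∀ x ∈ D, ∃ c : OnePoint ℂ,
      Tendsto (fun n => toSphere (f (ψ n) x)) atTop (𝓝 (toSphere c)) := by
    intro x hx
    obtain ⟨r, hr, C, hCpos, hC⟩ := hLψ x hx
    have hcau : CauchySeq fun n => toSphere (f (ψ n) x) := by
      rw [Metric.cauchySeq_iff]
      intro ε hε
      obtain ⟨k, hk⟩ := (TopologicalSpace.denseRange_denseSeq ℂ).exists_dist_lt x
        (show 0 < min r (ε / (3 * C)) by positivity)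
      have hkr : TopologicalSpace.denseSeq ℂ k ∈ Metric.ball x r := by
        rw [Metric.mem_ball, dist_comm]; exact hk.trans_le (min_le_left _ _)
      have hk3 : C * dist x (TopologicalSpace.denseSeq ℂ k) < ε / 3 := by
        have := mul_lt_mul_of_pos_left (hk.trans_le (min_le_right _ _)) hCpos
        have h2 : C * (ε / (3 * C)) = ε / 3 := by field_simp
        rwa [h2] at this
      obtain ⟨N₁, hN₁⟩ := eventually_atTop.1 hC
      obtain ⟨N₂, hN₂⟩ := Metric.cauchySeq_iff.1 (hlim k).cauchySeq (ε / 3) (by positivity)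
      refine ⟨max N₁ N₂, fun m hm n hn => ?_⟩
      have h1 := hN₁ m (le_of_max_le_left hm) _ hkr x (Metric.mem_ball_self hr)
      have h2 := hN₁ n (le_of_max_le_left hn) _ hkr x (Metric.mem_ball_self hr)
      have h3 := hN₂ m (le_of_max_le_right hm) n (le_of_max_le_right hn)
      rw [dist_comm] at h2
      have h4 := dist_triangle4 (toSphere (f (ψ m) x))
        (toSphere (f (ψ m) (TopologicalSpace.denseSeq ℂ k)))
        (toSphere (f (ψ n) (TopologicalSpace.denseSeq ℂ k))) (toSphere (f (ψ n) x))
      simp only [Function.comp_apply] at h3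
      linarith
    obtain ⟨y, hy⟩ := cauchySeq_tendsto_of_complete hcau
    obtain ⟨c, rfl⟩ := isClosedEmbedding_toSphere.isClosed_range.mem_of_tendsto hy
      (Eventually.of_forall fun n => Set.mem_range_self _)
    exact ⟨c, hy⟩
  choose! h hh using hconv
  refine ⟨ψ, hψ, h, Metric.tendstoLocallyUniformlyOn_iff.2 fun ε hε x hx => ?_⟩
  obtain ⟨r, hr, C, hCpos, hC⟩ := hLψ x hx
  have hη : 0 < min r (ε / (3 * C)) := by positivity
  refine ⟨Metric.ball x (min r (ε / (3 * C))) ∩ D,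
    inter_mem (mem_nhdsWithin_of_mem_nhds (Metric.ball_mem_nhds x hη)) self_mem_nhdsWithin, ?_⟩
  have hlimx := Metric.tendsto_nhds.1 (hh x hx) (ε / 3) (by positivity)
  filter_upwards [hC, hlimx] with n hn hnx z hz
  have hzr : z ∈ Metric.ball x r := Metric.ball_subset_ball (min_le_left _ _) hz.1
  have hz3 : C * dist z x < ε / 3 := by
    have := mul_lt_mul_of_pos_left ((Metric.mem_ball.1 hz.1).trans_le (min_le_right _ _)) hCpos
    have h2 : C * (ε / (3 * C)) = ε / 3 := by field_simp
    rwa [h2] at this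
  have h1 := hn x (Metric.mem_ball_self hr) z hzr
  have h2 : dist (toSphere (h z)) (toSphere (h x)) ≤ C * dist z x :=
    le_of_tendsto ((hh z hz.2).dist (hh x hx))
      (hC.mono fun n hn => hn x (Metric.mem_ball_self hr) z hzr)
  have h4 := dist_triangle4 (toSphere (h z)) (toSphere (h x)) (toSphere (f (ψ n) x))
    (toSphere (f (ψ n) z))
  rw [dist_comm] at hnx h1
  linarith

lemma continuousAt_chartZero {a : OnePoint ℂ} (ha : a ≠ OnePoint.infty) :
    ContinuousAt chartZero a := by
  obtain ⟨z, rfl⟩ := OnePoint.ne_infty_iff_exists.1 ha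
  exact OnePoint.continuousAt_coe.2 continuousAt_id

/-- The Weierstrass limit theorem in the affine chart, near a point where the limit is finite. -/
lemma differentiableAt_chartZero_of_tendstoLocallyUniformlyOn {B : Set ℂ} (hB : IsOpen B)
    {f : ℕ → ℂ → OnePoint ℂ} {h : ℂ → OnePoint ℂ}
    (hlim : TendstoLocallyUniformlyOn (fun n z => toSphere (f n z)) (fun z => toSphere (h z))
      atTop B)
    (hf : ∀ᶠ n in atTop, ∀ z ∈ B, HolomorphicAt (f n) z) {x : ℂ} (hx : x ∈ B)
    (hc : ContinuousAt h x) (hhx : h x ≠ OnePoint.infty) :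
    DifferentiableAt ℂ (fun z => chartZero (h z)) x := by
  rw [Metric.tendstoLocallyUniformlyOn_iff] at hlim
  simp only [dist_toSphere] at hlim
  set M : ℝ := ‖chartZero (h x)‖ + 1 with hM
  have hM0 : 0 < M := by positivity
  have hbound : ∀ᶠ z in 𝓝 x, ‖chartZero (h z)‖ < M :=
    ((continuousAt_chartZero hhx).comp hc).norm.eventually_lt_const (lt_add_one _)
  obtain ⟨t, ht, hte⟩ := hlim (1 / Real.sqrt (1 + M ^ 2)) (by positivity) x hx
  rw [hB.nhdsWithin_eq hx] at ht
  obtain ⟨ρ, hρ, hV⟩ := Metric.mem_nhds_iff.1 (inter_mem (inter_mem ht (hB.mem_nhds hx))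
    (inter_mem hbound (hc.eventually_ne hhx)))
  -- on this ball the limit stays in a bounded part of the plane, and so do the `f n`
  have hchart : ∀ z ∈ Metric.ball x ρ, ∀ a : OnePoint ℂ,
      sphericalDist (h z) a < 1 / Real.sqrt (1 + M ^ 2) →
      a ≠ OnePoint.infty ∧
        ‖chartZero a - chartZero (h z)‖ ≤ (1 + M ^ 2) * sphericalDist (h z) a := by
    intro z hz a ha
    have hzM : ‖chartZero (h z)‖ < M := (hV hz).2.1
    have hz2 : 1 + ‖chartZero (h z)‖ ^ 2 ≤ 1 + M ^ 2 := by gcongr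
    rw [sphericalDist_comm] at ha ⊢
    obtain ⟨h1, h2⟩ := ne_infty_and_norm_chartZero_sub_le (hV hz).2.2
      (ha.le.trans (one_div_le_one_div_of_le (by positivity) (Real.sqrt_le_sqrt hz2)))
    exact ⟨h1, h2.trans (mul_le_mul_of_nonneg_right hz2 (sphericalDist_nonneg _ _))⟩
  have hTLU : TendstoLocallyUniformlyOn (fun n z => chartZero (f n z))
      (fun z => chartZero (h z)) atTop (Metric.ball x ρ) := by
    rw [Metric.tendstoLocallyUniformlyOn_iff]
    intro ε hε y hy
    obtain ⟨s, hs, hse⟩ := hlim (min (1 / Real.sqrt (1 + M ^ 2)) (ε / (1 + M ^ 2)))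
      (by positivity) y (hV hy).1.2
    rw [hB.nhdsWithin_eq (hV hy).1.2] at hs
    refine ⟨s ∩ Metric.ball x ρ, inter_mem (mem_nhdsWithin_of_mem_nhds hs) self_mem_nhdsWithin, ?_⟩
    filter_upwards [hse] with n hn z hz
    have hnz := hn z hz.1
    rw [dist_comm, dist_eq_norm]
    refine (hchart z hz.2 _ (hnz.trans_le (min_le_left _ _))).2.trans_lt ?_
    have := (lt_div_iff₀' (by positivity)).1 (hnz.trans_le (min_le_right _ _))
    exact this
  refine (hTLU.differentiableOn ?_ Metric.isOpen_ball).differentiableAt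
    (Metric.ball_mem_nhds x hρ)
  filter_upwards [hf, hte] with n hn hnt z hz
  exact ((hn z (hV hz).1.2).2.1 (hchart z hz _ (hnt z (hV hz).1.1)).1).differentiableWithinAt

/-- Locally uniform limits of sphere-valued holomorphic maps are holomorphic; the index from which
the maps are holomorphic may depend on the place. -/
lemma holomorphicOn_of_tendstoLocallyUniformlyOn {D : Set ℂ} (hD : IsOpen D)
    {f : ℕ → ℂ → OnePoint ℂ} {h : ℂ → OnePoint ℂ}
    (hlim : TendstoLocallyUniformlyOn (fun n z => toSphere (f n z)) (fun z => toSphere (h z))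
      atTop D)
    (hf : ∀ x ∈ D, ∃ r > 0, ∀ᶠ n in atTop, ∀ z ∈ Metric.ball x r, HolomorphicAt (f n) z) :
    HolomorphicOn h D := by
  rw [holomorphicOn_iff_of_isOpen hD]
  intro x hx
  obtain ⟨r, hr, hr'⟩ := hf x hx
  set B : Set ℂ := D ∩ Metric.ball x r
  have hB : IsOpen B := hD.inter Metric.isOpen_ball
  have hxB : x ∈ B := ⟨hx, Metric.mem_ball_self hr⟩
  have hlimB := hlim.mono (show B ⊆ D from Set.inter_subset_left)
  have hfB : ∀ᶠ n in atTop, ∀ z ∈ B, HolomorphicAt (f n) z :=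
    hr'.mono fun n hn z hz => hn z hz.2
  have hcB : ContinuousOn (fun z => toSphere (h z)) B :=
    hlimB.continuousOn (hfB.frequently.mono fun n hn z hz =>
      (continuous_toSphere.continuousAt.comp (hn z hz).1).continuousWithinAt)
  have hc : ContinuousAt h x :=
    isClosedEmbedding_toSphere.isInducing.continuousAt_iff.2 (hcB.continuousAt (hB.mem_nhds hxB))
  refine ⟨hc, fun h1 =>
    differentiableAt_chartZero_of_tendstoLocallyUniformlyOn hB hlimB hfB hxB hc h1, fun h1 => ?_⟩
  have hlimJ : TendstoLocallyUniformlyOn (fun n z => toSphere (inversion (f n z)))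
      (fun z => toSphere (inversion (h z))) atTop B := by
    rw [Metric.tendstoLocallyUniformlyOn_iff] at hlimB ⊢
    simpa only [dist_toSphere, sphericalDist_inversion] using hlimB
  have := differentiableAt_chartZero_of_tendstoLocallyUniformlyOn hB hlimJ
    (hfB.mono fun n hn z hz => (hn z hz).inversion) hxB
    (continuous_inversion.continuousAt.comp hc) (fun h2 => h1 (inversion_eq_infty.1 h2))
  simpa only [chartZero_inversion] using this

/-- Cauchy's estimate: a map close to a constant on the unit disc about `x` has small spherical
derivative at `x`. -/
lemma exists_sphericalDeriv_lt_one (c : OnePoint ℂ) : ∃ ε > 0, ∀ (f : ℂ → OnePoint ℂ) (x : ℂ),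
    (∀ z ∈ Metric.closedBall x 1, HolomorphicAt f z) →
    (∀ z ∈ Metric.closedBall x 1, sphericalDist (f z) c < ε) → sphericalDeriv f x < 1 := by
  have key : ∀ c : OnePoint ℂ, c ≠ OnePoint.infty → ∃ ε > 0, ∀ (f : ℂ → OnePoint ℂ) (x : ℂ),
      (∀ z ∈ Metric.closedBall x 1, HolomorphicAt f z) →
      (∀ z ∈ Metric.closedBall x 1, sphericalDist (f z) c < ε) → sphericalDeriv f x < 1 := by
    intro c hc
    set S := 1 + ‖chartZero c‖ ^ 2 with hS
    refine ⟨min (1 / Real.sqrt S) (1 / (4 * S)), by positivity, fun f x hf hd => ?_⟩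
    have hch := fun z hz => ne_infty_and_norm_chartZero_sub_le hc
      ((hd z hz).le.trans (min_le_left _ _))
    have hx : x ∈ Metric.closedBall x 1 := Metric.mem_closedBall_self zero_le_one
    rw [(hf x hx).sphericalDeriv_eq (hch x hx).1]
    have hdiff : DifferentiableOn ℂ (fun z => chartZero (f z) - chartZero c)
        (Metric.closedBall x 1) := fun z hz =>
      (((hf z hz).2.1 (hch z hz).1).sub_const _).differentiableWithinAt
    have hder : ‖deriv (fun z => chartZero (f z) - chartZero c) x‖ ≤ (1 / 4) / 1 := by
      refine Complex.norm_deriv_le_of_forall_mem_sphere_norm_le one_pos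
        (DifferentiableOn.diffContOnCl (by rwa [closure_ball x one_ne_zero])) fun z hz => ?_
      have hz' := Metric.sphere_subset_closedBall hz
      refine (hch z hz').2.trans ?_
      have h1 := (hd z hz').le.trans (min_le_right _ _)
      have h2 := mul_le_mul_of_nonneg_left h1 (show 0 ≤ S by positivity)
      have hS0 : S ≠ 0 := by positivity
      have h3 : S * (1 / (4 * S)) = 1 / 4 := by field_simp
      rwa [h3] at h2
    rw [deriv_sub_const] at hder
    rw [div_lt_one (by positivity)]
    have := sq_nonneg ‖chartZero (f x)‖
    linarith
  by_cases hc : c = OnePoint.infty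
  · obtain ⟨ε, hε, h⟩ := key (inversion c) (by rw [hc]; exact OnePoint.coe_ne_infty 0)
    refine ⟨ε, hε, fun f x hf hd => ?_⟩
    rw [← sphericalDeriv_inversion]
    exact h _ x (fun z hz => (hf z hz).inversion) fun z hz => by
      rw [sphericalDist_inversion]; exact hd z hz
  · exact key c hc


/-- Marty's theorem: sphere-valued holomorphic maps with locally bounded spherical derivatives form
a normal family. -/
lemma exists_subseq_of_sphericalDeriv_le {D : Set ℂ} (hD : IsOpen D) {f : ℕ → ℂ → OnePoint ℂ}
    (hf : ∀ x ∈ D, ∃ r > 0, ∃ C : ℝ, ∀ᶠ n in atTop, ∀ z ∈ Metric.ball x r,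
      HolomorphicAt (f n) z ∧ sphericalDeriv (f n) z ≤ C) :
    ∃ ψ : ℕ → ℕ, StrictMono ψ ∧ ∃ h : ℂ → OnePoint ℂ, HolomorphicOn h D ∧
      TendstoLocallyUniformlyOn (fun n z => toSphere (f (ψ n) z)) (fun z => toSphere (h z))
        atTop D := by
  obtain ⟨ψ, hψ, h, hh⟩ := exists_subseq_tendstoLocallyUniformlyOn (D := D) (f := f)
    fun x hx => by
      obtain ⟨r, hr, C, hC⟩ := hf x hx
      exact ⟨r, hr, C, hC.mono fun n hn z hz w hw => sphericalDist_le_of_sphericalDeriv_le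
        (convex_ball x r) (fun y hy => (hn y hy).1) (fun y hy => (hn y hy).2) hz hw⟩
  refine ⟨ψ, hψ, h, holomorphicOn_of_tendstoLocallyUniformlyOn hD hh fun x hx => ?_, hh⟩
  obtain ⟨r, hr, C, hC⟩ := hf x hx
  exact ⟨r, hr, (hψ.tendsto_atTop.eventually hC).mono fun n hn z hz => (hn z hz).1⟩

lemma eventually_sphericalDist_lt {D K : Set ℂ} (hD : IsOpen D) (hKD : K ⊆ D) (hK : IsCompact K)
    {f : ℕ → ℂ → OnePoint ℂ} {h : ℂ → OnePoint ℂ}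
    (hlim : TendstoLocallyUniformlyOn (fun n z => toSphere (f n z)) (fun z => toSphere (h z))
      atTop D) {ε : ℝ} (hε : 0 < ε) :
    ∀ᶠ n in atTop, ∀ z ∈ K, sphericalDist (f n z) (h z) < ε := by
  have := Metric.tendstoUniformlyOn_iff.1
    ((tendstoLocallyUniformlyOn_iff_forall_isCompact hD).1 hlim K hKD hK) ε hε
  filter_upwards [this] with n hn z hz
  rw [sphericalDist_comm, ← dist_toSphere]
  exact hn z hz

/-! ### Zalcman's renormalisation -/

/-- Zalcman's choice of centre and scale: maximise the product of `s` with the distance to the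
boundary of the disc. -/
lemma exists_rescaling {s : ℂ → ℝ} {z₀ : ℂ} {R N : ℝ} (hR : 0 < R) (hN : 0 < N)
    (hs : ContinuousOn s (Metric.closedBall z₀ R)) (hs0 : ∀ z ∈ Metric.closedBall z₀ R, 0 ≤ s z)
    (h : N < R * s z₀) :
    ∃ (p : ℂ) (r : ℝ), 0 < r ∧ r * s p = 1 ∧ r * N ≤ R ∧
      Metric.ball p (r * N) ⊆ Metric.ball z₀ R ∧
      ∀ z ∈ Metric.ball p (r * (N / 2)), r * s z ≤ 2 := by
  obtain ⟨p, hp, hmax⟩ := (isCompact_closedBall z₀ R).exists_isMaxOn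
    ⟨z₀, Metric.mem_closedBall_self hR.le⟩
    (f := fun z => (R - dist z z₀) * s z) (ContinuousOn.mul (by fun_prop) hs)
  have hp0 : R * s z₀ ≤ (R - dist p z₀) * s p := by
    have := hmax (Metric.mem_closedBall_self hR.le)
    simpa using this
  have hd0 : 0 ≤ R - dist p z₀ := sub_nonneg.2 hp
  have hprod : 0 < (R - dist p z₀) * s p := by linarith
  have hd : 0 < R - dist p z₀ := pos_of_mul_pos_left hprod (hs0 p hp)
  have hsp : 0 < s p := pos_of_mul_pos_right hprod hd0
  have hNd : (s p)⁻¹ * N < R - dist p z₀ := by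
    rw [inv_mul_lt_iff₀ hsp]; linarith
  have hsub : Metric.ball p ((s p)⁻¹ * N) ⊆ Metric.ball z₀ R :=
    Metric.ball_subset_ball' (by linarith)
  refine ⟨p, (s p)⁻¹, inv_pos.2 hsp, inv_mul_cancel₀ hsp.ne', ?_, hsub, fun z hz => ?_⟩
  · linarith [dist_nonneg (x := p) (y := z₀)]
  · have hz' : z ∈ Metric.closedBall z₀ R := by
      refine Metric.ball_subset_closedBall (hsub (Metric.ball_subset_ball ?_ hz))
      gcongr
      linarith
    have h1 : (R - dist z z₀) * s z ≤ (R - dist p z₀) * s p := hmax hz'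
    have h2 : (R - dist p z₀) / 2 ≤ R - dist z z₀ := by
      have := dist_triangle z p z₀
      have := Metric.mem_ball.1 hz
      linarith
    have h3 := mul_le_mul_of_nonneg_right h2 (hs0 z hz')
    rw [inv_mul_le_iff₀ hsp]
    refine le_of_mul_le_mul_left ?_ hd
    linarith

/-- Where the spherical derivative grows faster than `1 / ‖z - v‖`, rescaling produces a
non-constant map on the whole plane. -/
lemma exists_rescaling_limit_univ {g : ℂ → OnePoint ℂ} {v : ℂ} {ρ : ℝ} (hρ : 0 < ρ)
    (hg : ∀ z ∈ Metric.ball v ρ \ {v}, HolomorphicAt g z)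
    (hunb : ∀ C : ℝ, ∀ δ > 0, ∃ z ∈ Metric.ball v δ \ {v}, C < dist z v * sphericalDeriv g z) :
    ∃ (vs : ℕ → ℂ) (r : ℕ → ℝ) (h : ℂ → OnePoint ℂ),
      Tendsto vs atTop (𝓝 v) ∧ (∀ n, 0 < r n) ∧ Tendsto r atTop (𝓝 0) ∧
      HolomorphicOn h Set.univ ∧ ¬ IsConstantOn h Set.univ ∧
      RescalingsConverge g (Metric.ball v ρ \ {v}) vs r h Set.univ := by
  have hopen : IsOpen (Metric.ball v ρ \ {v}) := Metric.isOpen_ball.sdiff isClosed_singleton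
  have hcont := ((holomorphicOn_iff_of_isOpen hopen).2 hg).continuousOn_sphericalDeriv hopen
  -- the `n`-th rescaled map lives on the disc of radius `n + 1`, and is controlled on half of it
  have step : ∀ n : ℕ, ∃ (p : ℂ) (r : ℝ), 0 < r ∧ r ≤ 1 / ((n : ℝ) + 1) ∧
      dist p v ≤ 2 * (1 / ((n : ℝ) + 1)) ∧ r * sphericalDeriv g p = 1 ∧
      Metric.ball p (r * (n + 1)) ⊆ Metric.ball v ρ \ {v} ∧
      ∀ z ∈ Metric.ball p (r * ((n + 1) / 2)), r * sphericalDeriv g z ≤ 2 := by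
    intro n
    have hn : (0 : ℝ) < (n : ℝ) + 1 := by positivity
    obtain ⟨z₀, ⟨hz₀, hz₀v⟩, hbig⟩ := hunb (2 * (n + 1)) (min (ρ / 2) (1 / ((n : ℝ) + 1)))
      (by positivity)
    have hd : 0 < dist z₀ v := dist_pos.2 hz₀v
    have hzρ := (Metric.mem_ball.1 hz₀).trans_le (min_le_left _ _)
    have hzn := (Metric.mem_ball.1 hz₀).trans_le (min_le_right _ _)
    have hsub : Metric.closedBall z₀ (dist z₀ v / 2) ⊆ Metric.ball v ρ \ {v} := by
      intro z hz
      have hz := Metric.mem_closedBall.1 hz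
      refine ⟨Metric.mem_ball.2 ?_, ?_⟩
      · linarith [dist_triangle z z₀ v]
      · rintro rfl
        rw [dist_comm] at hz
        linarith
    obtain ⟨p, r, hr, hrp, hrR, hball, hle⟩ := exists_rescaling (half_pos hd) hn
      (hcont.mono hsub) (fun z hz => (hg z (hsub hz)).sphericalDeriv_nonneg) (by linarith)
    refine ⟨p, r, hr, ?_, ?_, hrp, hball.trans (Metric.ball_subset_closedBall.trans hsub), hle⟩
    · have : r * 1 ≤ r * ((n : ℝ) + 1) := by gcongr; linarith [n.cast_nonneg (α := ℝ)]
      linarith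
    · have := Metric.mem_ball.1 (hball (Metric.mem_ball_self (by positivity)))
      linarith [dist_triangle p z₀ v]
  choose p r hr hrn hpn hrp hsub hle using step
  have hmem : ∀ n : ℕ, ∀ z : ℂ, ∀ M : ℝ, ‖z‖ < M → p n + r n * z ∈ Metric.ball (p n) (r n * M) := by
    intro n z M hz
    rw [Metric.mem_ball, dist_eq_norm, add_sub_cancel_left, norm_mul, Complex.norm_real,
      Real.norm_of_nonneg (hr n).le]
    exact mul_lt_mul_of_pos_left hz (hr n)
  have hat : ∀ n : ℕ, ∀ z : ℂ, ‖z‖ < n + 1 → HolomorphicAt (fun z => g (p n + r n * z)) z :=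
    fun n z hz => (hg _ (hsub n (hmem n z _ hz))).comp_affine
  have hlarge : ∀ M : ℝ, ∀ᶠ n : ℕ in atTop, M < ((n : ℝ) + 1) / 2 := fun M =>
    ((tendsto_atTop_add_const_right _ _ tendsto_natCast_atTop_atTop).atTop_div_const
      two_pos).eventually_gt_atTop M
  obtain ⟨ψ, hψ, h, hh, hlim⟩ := exists_subseq_of_sphericalDeriv_le isOpen_univ
    (f := fun n z => g (p n + r n * z)) fun x _ => ⟨1, one_pos, 2, by
      filter_upwards [hlarge (‖x‖ + 1)] with n hn z hz
      have hzn : ‖z‖ < ((n : ℝ) + 1) / 2 := by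
        have := norm_sub_norm_le z x
        have := mem_ball_iff_norm.1 hz
        linarith
      have hzn' : ‖z‖ < (n : ℝ) + 1 := by linarith [n.cast_nonneg (α := ℝ)]
      refine ⟨hat n z hzn', ?_⟩
      rw [HolomorphicAt.sphericalDeriv_comp_affine (hr n) (hg _ (hsub n (hmem n z _ hzn')))]
      exact hle n _ (hmem n z _ hzn)⟩
  have hone : Tendsto (fun n : ℕ => 1 / ((n : ℝ) + 1)) atTop (𝓝 0) :=
    tendsto_one_div_add_atTop_nhds_zero_nat
  refine ⟨fun n => p (ψ n), fun n => r (ψ n), h, ?_, fun n => hr _, ?_, hh, ?_, ?_⟩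
  · refine Tendsto.comp (g := p) ?_ hψ.tendsto_atTop
    rw [tendsto_iff_dist_tendsto_zero]
    exact squeeze_zero (fun _ => dist_nonneg) hpn (by simpa using hone.const_mul 2)
  · exact (squeeze_zero (fun n => (hr n).le) hrn hone).comp hψ.tendsto_atTop
  · rintro ⟨c, hc⟩
    obtain ⟨ε, hε, hsmall⟩ := exists_sphericalDeriv_lt_one c
    obtain ⟨n, hn1, hn2⟩ := ((eventually_sphericalDist_lt isOpen_univ (Set.subset_univ _)
      (isCompact_closedBall (0 : ℂ) 1) hlim hε).and
      (hψ.tendsto_atTop.eventually (hlarge 1))).exists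
    have hlt := hsmall (fun z => g (p (ψ n) + r (ψ n) * z)) 0
      (fun z hz => hat _ z (by
        have := mem_closedBall_zero_iff.1 hz
        linarith))
      (fun z hz => by rw [← hc z trivial]; exact hn1 z hz)
    rw [HolomorphicAt.sphericalDeriv_comp_affine (hr _)
      (hg _ (hsub _ (hmem _ 0 _ (by rw [norm_zero]; positivity)))), mul_zero, add_zero, hrp] at hlt
    exact lt_irrefl _ hlt
  · intro K hKD hK
    refine ⟨?_, fun ε hε => eventually_sphericalDist_lt isOpen_univ hKD hK hlim hε⟩
    obtain ⟨M, hM⟩ := hK.isBounded.exists_norm_le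
    filter_upwards [hψ.tendsto_atTop.eventually (hlarge (max M 0))] with n hn z hz
    refine hsub _ (hmem _ z _ ?_)
    have := hM z hz
    have := le_max_left M 0
    have := le_max_right M 0
    linarith

/-! ### Shrinking images of circles about an isolated singularity -/

/-- An affine coordinate on the Riemann sphere with its pole at the finite point `a` (with a dummy
value there), scaled so that it has the simple distortion of `norm_poleChart_sub`. -/
noncomputable def poleChart (a : ℂ) : OnePoint ℂ → ℂ
  | OnePoint.infty => 0
  | OnePoint.some z => ((1 + ‖a‖ ^ 2) / 2 : ℝ) / (z - a)

lemma norm_poleChart_sub {a : ℂ} {b c : OnePoint ℂ} (hb : b ≠ a) (hc : c ≠ a) :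
    ‖poleChart a b - poleChart a c‖ =
      sphericalDist b c / (sphericalDist b a * sphericalDist c a) := by
  have hS : 0 < Real.sqrt (1 + ‖a‖ ^ 2) := by positivity
  have hS2 : Real.sqrt (1 + ‖a‖ ^ 2) ^ 2 = 1 + ‖a‖ ^ 2 := Real.sq_sqrt (by positivity)
  have hne : ∀ z : ℂ, (z : OnePoint ℂ) ≠ a → z - a ≠ 0 := fun z hz h =>
    hz (by rw [sub_eq_zero.1 h])
  have key : ∀ z : ℂ, (z : OnePoint ℂ) ≠ a →
      ‖poleChart a z - poleChart a OnePoint.infty‖ = sphericalDist z OnePoint.infty /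
        (sphericalDist z a * sphericalDist OnePoint.infty a) := by
    intro z hz
    have hz0 : ‖z - a‖ ≠ 0 := norm_ne_zero_iff.2 (hne z hz)
    rw [sphericalDist_comm OnePoint.infty, sphericalDist_coe_infty, sphericalDist_coe_infty,
      sphericalDist_coe_coe]
    simp only [poleChart]
    have hT : 0 < Real.sqrt (1 + ‖z‖ ^ 2) := by positivity
    rw [sub_zero, norm_div, Complex.norm_real, Real.norm_of_nonneg (by positivity), ← hS2]
    generalize Real.sqrt (1 + ‖z‖ ^ 2) = T at *
    rw [hS2]
    generalize Real.sqrt (1 + ‖a‖ ^ 2) = S at *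
    rw [← hS2]
    field_simp
  rcases b with _ | z <;> rcases c with _ | w
  · change ‖poleChart a OnePoint.infty - poleChart a OnePoint.infty‖ =
      sphericalDist OnePoint.infty OnePoint.infty / _
    rw [sub_self, norm_zero, sphericalDist_self, zero_div]
  · have := key w hc
    rw [norm_sub_rev, sphericalDist_comm (w : OnePoint ℂ) OnePoint.infty, mul_comm] at this
    exact this
  · exact key z hb
  · have hz0 := hne z hb
    have hw0 := hne w hc
    have hz1 : ‖z - a‖ ≠ 0 := norm_ne_zero_iff.2 hz0
    have hw1 : ‖w - a‖ ≠ 0 := norm_ne_zero_iff.2 hw0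
    change ‖(((1 + ‖a‖ ^ 2) / 2 : ℝ) : ℂ) / (z - a) - (((1 + ‖a‖ ^ 2) / 2 : ℝ) : ℂ) / (w - a)‖ =
      sphericalDist (z : OnePoint ℂ) (w : OnePoint ℂ) / (sphericalDist (z : OnePoint ℂ) a *
        sphericalDist (w : OnePoint ℂ) a)
    have h1 : (((1 + ‖a‖ ^ 2) / 2 : ℝ) : ℂ) / (z - a) - (((1 + ‖a‖ ^ 2) / 2 : ℝ) : ℂ) / (w - a) =
        (((1 + ‖a‖ ^ 2) / 2 : ℝ) : ℂ) * (w - z) / ((z - a) * (w - a)) := by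
      field_simp
      ring
    rw [h1, norm_div, norm_mul, norm_mul, Complex.norm_real, Real.norm_of_nonneg (by positivity),
      sphericalDist_coe_coe, sphericalDist_coe_coe, sphericalDist_coe_coe, norm_sub_rev w z]
    have hT : 0 < Real.sqrt (1 + ‖z‖ ^ 2) := by positivity
    have hU : 0 < Real.sqrt (1 + ‖w‖ ^ 2) := by positivity
    generalize Real.sqrt (1 + ‖z‖ ^ 2) = T at *
    generalize Real.sqrt (1 + ‖w‖ ^ 2) = U at *
    generalize Real.sqrt (1 + ‖a‖ ^ 2) = S at *
    rw [← hS2]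
    field_simp

lemma HolomorphicAt.differentiableAt_poleChart {f : ℂ → OnePoint ℂ} {x a : ℂ}
    (hf : HolomorphicAt f x) (hx : f x ≠ a) :
    DifferentiableAt ℂ (fun z => poleChart a (f z)) x := by
  by_cases hinf : f x = OnePoint.infty
  · have hx0 : f x ≠ OnePoint.some 0 := by rw [hinf]; exact OnePoint.infty_ne_coe 0
    have hu := hf.2.2 hx0
    have hux : chartInfty (f x) = 0 := by rw [hinf]; rfl
    have hd : DifferentiableAt ℂ (fun z => ((1 + ‖a‖ ^ 2) / 2 : ℝ) * chartInfty (f z) /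
        (1 - a * chartInfty (f z))) x :=
      (hu.const_mul _).div ((hu.const_mul a).const_sub 1) (by rw [hux]; simp)
    -- with `u = chartInfty ∘ f`, the coordinate `1 / (f - a)` reads `u / (1 - a * u)`
    refine hd.congr_of_eventuallyEq ?_
    filter_upwards [hf.1.eventually_ne hx0] with z hz
    rcases hfz : f z with _ | w
    · simp [poleChart, chartInfty]
    · have hw : w ≠ 0 := by rintro rfl; exact hz hfz
      simp only [poleChart, chartInfty]
      have h2 : 1 - a * w⁻¹ = (w - a) * w⁻¹ := by field_simp
      rw [h2, mul_div_mul_right _ _ (inv_ne_zero hw)]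
  · have hu := hf.2.1 hinf
    have hxa : chartZero (f x) - a ≠ 0 := fun h => hx (by
      rw [← sub_eq_zero.1 h, coe_chartZero hinf])
    have hd : DifferentiableAt ℂ (fun z => (((1 + ‖a‖ ^ 2) / 2 : ℝ) : ℂ) /
        (chartZero (f z) - a)) x := (differentiableAt_const _).div (hu.sub_const a) hxa
    refine hd.congr_of_eventuallyEq ?_
    filter_upwards [hf.1.eventually_ne hinf] with z hz
    rcases hfz : f z with _ | w
    · exact absurd hfz hz
    · rfl

/-- The maximum principle on a round annulus. -/
lemma norm_le_of_annulus {F : ℂ → ℂ} {v : ℂ} {t₁ t₂ C : ℝ}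
    (hF : ∀ z, t₁ ≤ dist z v → dist z v ≤ t₂ → DifferentiableAt ℂ F z)
    (h₁ : ∀ z, dist z v = t₁ → ‖F z‖ ≤ C) (h₂ : ∀ z, dist z v = t₂ → ‖F z‖ ≤ C) {z : ℂ}
    (hz₁ : t₁ < dist z v) (hz₂ : dist z v < t₂) : ‖F z‖ ≤ C := by
  set U : Set ℂ := {z | t₁ < dist z v ∧ dist z v < t₂} with hU
  have hc : Continuous fun z : ℂ => dist z v := by fun_prop
  have hUo : IsOpen U := (isOpen_lt continuous_const hc).inter (isOpen_lt hc continuous_const)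
  have hcl : closure U ⊆ {z | t₁ ≤ dist z v ∧ dist z v ≤ t₂} :=
    closure_minimal (fun z hz => ⟨hz.1.le, hz.2.le⟩)
      ((isClosed_le continuous_const hc).inter (isClosed_le hc continuous_const))
  refine Complex.norm_le_of_forall_mem_frontier_norm_le
    (Metric.isBounded_ball.subset fun z hz => Metric.mem_ball.2 hz.2)
    (DifferentiableOn.diffContOnCl fun z hz =>
      (hF z (hcl hz).1 (hcl hz).2).differentiableWithinAt) (fun w hw => ?_)
    (subset_closure ⟨hz₁, hz₂⟩)
  rw [hUo.frontier_eq] at hw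
  rcases (hcl hw.1).1.eq_or_lt with h | h
  · exact h₁ w h.symm
  rcases (hcl hw.1).2.eq_or_lt with h' | h'
  · exact h₂ w h'
  · exact absurd ⟨h, h'⟩ hw.2

lemma exists_last_crossing {A : ℝ → ℝ} {p s δ : ℝ} (hps : p ≤ s)
    (hA : ContinuousOn A (Set.Icc p s)) (hp : A p < δ) (hs : δ < A s) :
    ∃ t, p ≤ t ∧ t < s ∧ A t = δ ∧ ∀ u ∈ Set.Icc t s, δ ≤ A u := by
  have hcl : IsCompact (Set.Icc p s ∩ A ⁻¹' Set.Iic δ) :=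
    isCompact_Icc.of_isClosed_subset (hA.preimage_isClosed_of_isClosed isClosed_Icc isClosed_Iic)
      Set.inter_subset_left
  obtain ⟨t, ⟨ht, htA⟩, htop⟩ := hcl.exists_isGreatest ⟨p, Set.left_mem_Icc.2 hps, hp.le⟩
  obtain ⟨u, hu, huA⟩ := intermediate_value_Icc ht.2
    (hA.mono (Set.Icc_subset_Icc_left ht.1)) ⟨htA, hs.le⟩
  have hut : u = t := le_antisymm (htop ⟨⟨ht.1.trans hu.1, hu.2⟩, huA.le⟩) hu.1
  rw [hut] at huA
  refine ⟨t, ht.1, lt_of_le_of_ne ht.2 ?_, huA, fun w hw => ?_⟩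
  · rintro rfl
    exact hs.ne' huA
  · rcases hw.1.eq_or_lt with rfl | h
    · exact huA.ge
    · by_contra hlt
      exact absurd (htop ⟨⟨ht.1.trans hw.1, hw.2⟩, (not_le.1 hlt).le⟩) (not_le.2 h)

lemma exists_first_crossing {A : ℝ → ℝ} {s p δ : ℝ} (hps : s ≤ p)
    (hA : ContinuousOn A (Set.Icc s p)) (hp : A p < δ) (hs : δ < A s) :
    ∃ t, s < t ∧ t ≤ p ∧ A t = δ ∧ ∀ u ∈ Set.Icc s t, δ ≤ A u := by
  obtain ⟨t, h1, h2, h3, h4⟩ := exists_last_crossing (A := fun u => A (-u)) (p := -p) (s := -s)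
    (neg_le_neg hps) (hA.comp continuous_neg.continuousOn fun u hu =>
      ⟨by linarith [hu.2], by linarith [hu.1]⟩) (by simpa using hp) (by simpa using hs)
  refine ⟨-t, by linarith, by linarith, h3, fun u hu => ?_⟩
  have := h4 (-u) ⟨by linarith [hu.2], by linarith [hu.1]⟩
  simpa using this

/-- If the images of small circles about an isolated singularity shrink to points, the singularity
is not essential. -/
lemma exists_tendsto_of_oscillation {g : ℂ → OnePoint ℂ} {v : ℂ} {ρ : ℝ} (hρ : 0 < ρ)
    (hg : ∀ z ∈ Metric.ball v ρ \ {v}, HolomorphicAt g z)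
    (hosc : ∀ ε > 0, ∃ η > 0, ∀ z ∈ Metric.ball v η \ {v}, ∀ w, dist w v = dist z v →
      sphericalDist (g z) (g w) < ε) :
    ∃ c, Tendsto g (𝓝[≠] v) (𝓝 c) := by
  by_contra hno
  have hclus : ∀ c : OnePoint ℂ, ∃ b, b ≠ c ∧ MapClusterPt b (𝓝[≠] v) g := by
    intro c
    by_contra! h
    exact hno ⟨c, le_nhds_of_unique_clusterPt fun y hy => by_contra fun hyc => h y hyc hy⟩
  obtain ⟨a', ha', hclusa⟩ := hclus OnePoint.infty
  obtain ⟨a, rfl⟩ := OnePoint.ne_infty_iff_exists.1 ha'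
  obtain ⟨b, hba, hclusb⟩ := hclus a
  have hcontd : Continuous fun c : OnePoint ℂ => sphericalDist c a :=
    continuous_sphericalDist.comp (continuous_id.prodMk continuous_const)
  have hd : 0 < sphericalDist b a :=
    (sphericalDist_nonneg _ _).lt_of_ne fun h => hba (eq_of_sphericalDist_eq_zero h.symm)
  -- the levels `δ` and `2 * δ` lie strictly between the cluster values `0` and `sphericalDist b a`
  -- of `sphericalDist (g z) a`, with room for the oscillation `δ / 30` on circles
  obtain ⟨δ, hδ, hδd⟩ : ∃ δ > 0, 3 * δ < sphericalDist b a :=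
    ⟨sphericalDist b a / 4, by positivity, by linarith⟩
  obtain ⟨η', hη', hosc'⟩ := hosc (δ / 30) (by positivity)
  obtain ⟨η, hη, hηρ, hηη⟩ : ∃ η > 0, η ≤ ρ ∧ η ≤ η' :=
    ⟨min ρ η', by positivity, min_le_left _ _, min_le_right _ _⟩
  -- `A t` is the distance from `a` to the image of the circle of radius `t`, up to `δ / 30`
  set A : ℝ → ℝ := fun t => sphericalDist (g (v + t)) a with hAdef
  have hdist : ∀ t : ℝ, 0 < t → dist (v + t) v = t := fun t ht => by
    rw [dist_eq_norm, add_sub_cancel_left, Complex.norm_real, Real.norm_of_nonneg ht.le]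
  have hne : ∀ z, 0 < dist z v → dist z v < η → HolomorphicAt g z := fun z h0 h1 =>
    hg z ⟨h1.trans_le hηρ, dist_pos.1 h0⟩
  have hosc : ∀ z, 0 < dist z v → dist z v < η →
      sphericalDist (g z) (g (v + dist z v)) < δ / 30 := fun z h0 h1 =>
    hosc' z ⟨h1.trans_le hηη, dist_pos.1 h0⟩ _ (hdist _ h0)
  have hnear : ∀ z, 0 < dist z v → dist z v < η →
      A (dist z v) - δ / 30 < sphericalDist (g z) a ∧
        sphericalDist (g z) a < A (dist z v) + δ / 30 := by
    intro z h0 h1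
    have h2 := hosc z h0 h1
    have h3 := sphericalDist_triangle (g z) (g (v + dist z v)) a
    have h4 := sphericalDist_triangle (g (v + dist z v)) (g z) a
    rw [sphericalDist_comm (g (v + dist z v)) (g z)] at h4
    constructor <;> simp only [hAdef] <;> linarith
  have hAcont : ∀ x y : ℝ, 0 < x → y < η → ContinuousOn A (Set.Icc x y) := by
    intro x y hx hy t ht
    have ht0 : 0 < t := hx.trans_le ht.1
    have h1 : ContinuousAt g (v + (t : ℂ)) := (hne _ (by rwa [hdist t ht0])
      (by rw [hdist t ht0]; exact ht.2.trans_lt hy)).1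
    have h2 : ContinuousAt (fun t : ℝ => v + (t : ℂ)) t := by fun_prop
    exact (hcontd.continuousAt.comp (ContinuousAt.comp (f := fun t : ℝ => v + (t : ℂ)) h1
      h2)).continuousWithinAt
  have hpunct : ∀ x > 0, ∀ᶠ z in 𝓝[≠] v, 0 < dist z v ∧ dist z v < x := fun x hx => by
    filter_upwards [self_mem_nhdsWithin, mem_nhdsWithin_of_mem_nhds (Metric.ball_mem_nhds v hx)]
      with z hz hzx using ⟨dist_pos.2 hz, hzx⟩
  have hsmall : ∀ x, 0 < x → x ≤ η → ∃ t, 0 < t ∧ t < x ∧ A t < δ := by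
    intro x hx hxη
    have hfreq := hclusa.frequently (p := fun c => sphericalDist c a < δ / 2)
      (hcontd.continuousAt.eventually_lt_const
        (by simpa only [sphericalDist_self] using half_pos hδ))
    obtain ⟨z, hz, hz0, hzx⟩ := (hfreq.and_eventually (hpunct x hx)).exists
    refine ⟨dist z v, hz0, hzx, ?_⟩
    linarith [(hnear z hz0 (hzx.trans_le hxη)).1]
  have hlarge : ∀ x, 0 < x → x ≤ η → ∃ t, 0 < t ∧ t < x ∧ 2 * δ < A t := by
    intro x hx hxη
    have hfreq := hclusb.frequently (p := fun c => 3 * δ < sphericalDist c a)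
      (hcontd.continuousAt.eventually_const_lt hδd)
    obtain ⟨z, hz, hz0, hzx⟩ := (hfreq.and_eventually (hpunct x hx)).exists
    refine ⟨dist z v, hz0, hzx, ?_⟩
    linarith [(hnear z hz0 (hzx.trans_le hxη)).2]
  obtain ⟨p₂, hp₂0, hp₂η, hAp₂⟩ := hsmall η hη le_rfl
  obtain ⟨s, hs0, hsp₂, hAs⟩ := hlarge p₂ hp₂0 hp₂η.le
  obtain ⟨p₁, hp₁0, hp₁s, hAp₁⟩ := hsmall s hs0 (hsp₂.trans hp₂η).le
  obtain ⟨t₁, hpt₁, ht₁s, hAt₁, hA₁⟩ := exists_last_crossing hp₁s.le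
    (hAcont p₁ s hp₁0 (hsp₂.trans hp₂η)) hAp₁ (by linarith)
  obtain ⟨t₂, hst₂, ht₂p, hAt₂, hA₂⟩ := exists_first_crossing hsp₂.le
    (hAcont s p₂ hs0 hp₂η) hAp₂ (by linarith)
  have ht₁0 : 0 < t₁ := hp₁0.trans_le hpt₁
  have ht₂0 : 0 < t₂ := hs0.trans hst₂
  -- the maximal annulus about the circle of radius `s` that `g` maps off a neighbourhood of `a`
  have hfar : ∀ z, t₁ ≤ dist z v → dist z v ≤ t₂ →
      0 < dist z v ∧ dist z v < η ∧ δ / 2 < sphericalDist (g z) a ∧ g z ≠ a := by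
    intro z h1 h2
    have h0 : 0 < dist z v := ht₁0.trans_le h1
    have hη1 : dist z v < η := (h2.trans ht₂p).trans_lt hp₂η
    have hA : δ ≤ A (dist z v) := by
      rcases le_total (dist z v) s with h | h
      · exact hA₁ _ ⟨h1, h⟩
      · exact hA₂ _ ⟨h, h2⟩
    have h3 : δ / 2 < sphericalDist (g z) a := by linarith [(hnear z h0 hη1).1]
    refine ⟨h0, hη1, h3, fun h => ?_⟩
    rw [h, sphericalDist_self] at h3
    linarith
  have hF : ∀ z, t₁ ≤ dist z v → dist z v ≤ t₂ →
      DifferentiableAt ℂ (fun z => poleChart a (g z)) z := fun z h1 h2 => by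
    obtain ⟨h3, h4, -, h5⟩ := hfar z h1 h2
    exact (hne z h3 h4).differentiableAt_poleChart h5
  set c₁ := poleChart a (g (v + t₁)) with hc₁
  set c₂ := poleChart a (g (v + t₂)) with hc₂
  -- on the circle of radius `t` with `A t = δ` the chart is nearly constant
  have hclose : ∀ t, t₁ ≤ t → t ≤ t₂ → A t = δ → ∀ z, dist z v = t →
      ‖poleChart a (g z) - poleChart a (g (v + t))‖ ≤ 1 / (15 * δ) := by
    rintro t h1 h2 hAt z rfl
    obtain ⟨h3, h4, h5, h6⟩ := hfar z h1 h2
    have h7 := hfar (v + dist z v) (by rwa [hdist _ h3]) (by rwa [hdist _ h3])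
    have h8 := hosc z h3 h4
    have h9 : sphericalDist (g (v + dist z v)) a = δ := hAt
    have h10 : 0 < sphericalDist (g z) a := by linarith
    rw [norm_poleChart_sub h6 h7.2.2.2, h9, div_le_div_iff₀ (by positivity) (by positivity)]
    nlinarith
  have hbdd : ∀ t, t₁ ≤ t → t ≤ t₂ → A t = δ → ∀ z, t₁ ≤ dist z v → dist z v ≤ t₂ →
      ‖poleChart a (g z) - poleChart a (g (v + t))‖ ≤ 3 / δ := by
    intro t ht1 ht2 hAt z h1 h2
    obtain ⟨h3, h4, h5, h6⟩ := hfar z h1 h2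
    have ht0 : 0 < t := ht₁0.trans_le ht1
    have h7 := hfar (v + t) (by rwa [hdist _ ht0]) (by rwa [hdist _ ht0])
    have h8 := sphericalDist_triangle (g z) a (g (v + t))
    rw [sphericalDist_comm (a : OnePoint ℂ)] at h8
    have h9 : sphericalDist (g (v + t)) a = δ := hAt
    have h10 : 0 < sphericalDist (g z) a := by linarith
    rw [norm_poleChart_sub h6 h7.2.2.2, h9, div_le_div_iff₀ (by positivity) hδ]
    rw [h9] at h8
    nlinarith
  have hst : ∀ t, t₁ ≤ t → t ≤ t₂ → A t = δ →
      1 / (2 * δ) ≤ ‖poleChart a (g (v + s)) - poleChart a (g (v + t))‖ := by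
    intro t ht1 ht2 hAt
    have ht0 : 0 < t := ht₁0.trans_le ht1
    have h7 := hfar (v + t) (by rwa [hdist _ ht0]) (by rwa [hdist _ ht0])
    have h6 := hfar (v + s) (by rw [hdist _ hs0]; exact ht₁s.le)
      (by rw [hdist _ hs0]; exact hst₂.le)
    have h8 := sphericalDist_triangle (g (v + s)) (g (v + t)) a
    have h9 : sphericalDist (g (v + t)) a = δ := hAt
    have h10 : 2 * δ < sphericalDist (g (v + s)) a := hAs
    have h11 : 0 < sphericalDist (g (v + s)) a := by linarith
    rw [norm_poleChart_sub h6.2.2.2 h7.2.2.2, h9, div_le_div_iff₀ (by positivity) (by positivity)]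
    rw [h9] at h8
    nlinarith
  have h12 : t₁ ≤ t₂ := (ht₁s.trans hst₂).le
  have hmax := norm_le_of_annulus (v := v) (t₁ := t₁) (t₂ := t₂) (C := 1 / (15 * δ) * (3 / δ))
    (F := fun z => (poleChart a (g z) - c₁) * (poleChart a (g z) - c₂))
    (fun z h1 h2 => ((hF z h1 h2).sub_const _).mul ((hF z h1 h2).sub_const _))
    (fun z hz => by
      rw [norm_mul]
      exact mul_le_mul (hclose t₁ le_rfl h12 hAt₁ z hz)
        (hbdd t₂ h12 le_rfl hAt₂ z hz.ge (hz.trans_le h12)) (norm_nonneg _) (by positivity))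
    (fun z hz => by
      rw [norm_mul, mul_comm]
      exact mul_le_mul (hclose t₂ h12 le_rfl hAt₂ z hz)
        (hbdd t₁ le_rfl h12 hAt₁ z (h12.trans hz.ge) hz.le) (norm_nonneg _) (by positivity))
    (z := v + s) (by rwa [hdist s hs0]) (by rwa [hdist s hs0])
  -- at radius `s` both factors are at least `1 / (2 * δ)`, which exceeds the boundary bound
  rw [norm_mul] at hmax
  have hmin := mul_le_mul (hst t₁ le_rfl h12 hAt₁) (hst t₂ h12 le_rfl hAt₂) (by positivity)
    (norm_nonneg _)
  have hcontra := hmin.trans hmax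
  have h1 : 1 / (2 * δ) * (1 / (2 * δ)) = (1 / 4) * (1 / δ ^ 2) := by field_simp; norm_num
  have h2 : 1 / (15 * δ) * (3 / δ) = (1 / 5) * (1 / δ ^ 2) := by field_simp; norm_num
  rw [h1, h2] at hcontra
  have h3 : 0 < 1 / δ ^ 2 := by positivity
  linarith

/-! ### Rescaling about the singularity -/

/-- Where the spherical derivative is at most of the order of `1 / ‖z - v‖`, rescaling about `v`
produces a map on the punctured plane, and this is non-constant for a suitable choice of scales. -/
lemma exists_rescaling_limit_punctured {g : ℂ → OnePoint ℂ} {v : ℂ} {ρ : ℝ} (hρ : 0 < ρ)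
    (hg : ∀ z ∈ Metric.ball v ρ \ {v}, HolomorphicAt g z) (hess : HasEssentialSingularityAt g v)
    {C δ : ℝ} (hδ : 0 < δ)
    (hbd : ∀ z ∈ Metric.ball v δ \ {v}, dist z v * sphericalDeriv g z ≤ C) :
    ∃ (r : ℕ → ℝ) (h : ℂ → OnePoint ℂ), (∀ n, 0 < r n) ∧ Tendsto r atTop (𝓝 0) ∧
      HolomorphicOn h {0}ᶜ ∧ ¬ IsConstantOn h {0}ᶜ ∧
      RescalingsConverge g (Metric.ball v ρ \ {v}) (fun _ => v) r h {0}ᶜ := by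
  by_contra hno
  refine hess (exists_tendsto_of_oscillation hρ hg ?_)
  by_contra! hosc
  obtain ⟨ε, hε, hosc⟩ := hosc
  choose z hz w hwz hzw using fun n : ℕ => hosc (1 / ((n : ℝ) + 1)) (by positivity)
  set r : ℕ → ℝ := fun n => dist (z n) v with hrdef
  have hr : ∀ n, 0 < r n := fun n => dist_pos.2 (hz n).2
  have hr0 : Tendsto r atTop (𝓝 0) :=
    squeeze_zero (fun n => (hr n).le) (fun n => (Metric.mem_ball.1 (hz n).1).le)
      tendsto_one_div_add_atTop_nhds_zero_nat
  have hopen : IsOpen ({0}ᶜ : Set ℂ) := isOpen_compl_singleton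
  have hdist : ∀ n : ℕ, ∀ u : ℂ, dist (v + r n * u) v = r n * ‖u‖ := fun n u => by
    rw [dist_eq_norm, add_sub_cancel_left, norm_mul, Complex.norm_real,
      Real.norm_of_nonneg (hr n).le]
  have hmem : ∀ n : ℕ, ∀ u : ℂ, ∀ x : ℝ, u ≠ 0 → r n * ‖u‖ < x →
      v + r n * u ∈ Metric.ball v x \ {v} := by
    intro n u x hu hux
    rw [← hdist] at hux
    refine ⟨hux, fun h => ?_⟩
    have h1 := hdist n u
    rw [h, dist_self] at h1
    exact (mul_pos (hr n) (norm_pos_iff.2 hu)).ne h1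
  have hsmall : ∀ M x : ℝ, 0 < x → ∀ᶠ n in atTop, r n * M < x := fun M x hx =>
    (by simpa using hr0.mul_const M : Tendsto (fun n => r n * M) atTop
      (𝓝 0)).eventually_lt_const hx
  obtain ⟨ψ, hψ, h, hh, hlim⟩ := exists_subseq_of_sphericalDeriv_le hopen
    (f := fun n u => g (v + r n * u)) fun x hx => by
      have hx0 : 0 < ‖x‖ := norm_pos_iff.2 hx
      refine ⟨‖x‖ / 2, half_pos hx0, |C| / (‖x‖ / 2), ?_⟩
      filter_upwards [hsmall (2 * ‖x‖) ρ hρ, hsmall (2 * ‖x‖) δ hδ] with n hnρ hnδ u hu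
      have hux := mem_ball_iff_norm.1 hu
      have hu1 : ‖x‖ / 2 ≤ ‖u‖ := by
        have := norm_sub_norm_le x u
        rw [norm_sub_rev] at this
        linarith
      have hu2 : ‖u‖ ≤ 2 * ‖x‖ := by linarith [norm_sub_norm_le u x]
      have hu0 : u ≠ 0 := norm_pos_iff.1 ((half_pos hx0).trans_le hu1)
      have hru : r n * ‖u‖ ≤ r n * (2 * ‖x‖) := mul_le_mul_of_nonneg_left hu2 (hr n).le
      have hat := hg _ (hmem n u ρ hu0 (hru.trans_lt hnρ))
      refine ⟨hat.comp_affine, ?_⟩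
      have hb := hbd _ (hmem n u δ hu0 (hru.trans_lt hnδ))
      rw [hdist] at hb
      rw [HolomorphicAt.sphericalDeriv_comp_affine (hr n) hat, le_div_iff₀ (half_pos hx0)]
      calc r n * sphericalDeriv g (v + r n * u) * (‖x‖ / 2)
          ≤ r n * sphericalDeriv g (v + r n * u) * ‖u‖ :=
            mul_le_mul_of_nonneg_left hu1 (mul_nonneg (hr n).le hat.sphericalDeriv_nonneg)
        _ = r n * ‖u‖ * sphericalDeriv g (v + r n * u) := by ring
        _ ≤ |C| := hb.trans (le_abs_self C)
  refine hno ⟨fun n => r (ψ n), h, fun n => hr _, hr0.comp hψ.tendsto_atTop, hh, ?_, ?_⟩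
  · -- a constant limit would make the image of the unit circle shrink to a point
    rintro ⟨c, hc⟩
    have hsub : Metric.sphere (0 : ℂ) 1 ⊆ {0}ᶜ := fun u hu h0 => by
      rw [Set.mem_singleton_iff.1 h0, mem_sphere_zero_iff_norm, norm_zero] at hu
      exact zero_ne_one hu
    obtain ⟨n, hn⟩ := (eventually_sphericalDist_lt hopen hsub (isCompact_sphere _ _) hlim
      (half_pos hε)).exists
    have hcircle : ∀ y : ℂ, dist y v = r (ψ n) → sphericalDist (g y) c < ε / 2 := by
      intro y hy
      have hr' : (r (ψ n) : ℂ) ≠ 0 := Complex.ofReal_ne_zero.2 (hr _).ne'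
      have hu : (y - v) / r (ψ n) ∈ Metric.sphere (0 : ℂ) 1 := by
        rw [mem_sphere_zero_iff_norm, norm_div, ← dist_eq_norm, hy, Complex.norm_real,
          Real.norm_of_nonneg (hr _).le, div_self (hr _).ne']
      have := hn _ hu
      rwa [mul_div_cancel₀ _ hr', add_sub_cancel, hc _ (hsub hu)] at this
    have h1 := hcircle (z (ψ n)) rfl
    have h2 := hcircle (w (ψ n)) (hwz _)
    have h3 := sphericalDist_triangle (g (z (ψ n))) c (g (w (ψ n)))
    rw [sphericalDist_comm c] at h3
    linarith [hzw (ψ n)]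
  · intro K hKD hK
    refine ⟨?_, fun ε hε => eventually_sphericalDist_lt hopen hKD hK hlim hε⟩
    obtain ⟨M, hM⟩ := hK.isBounded.exists_norm_le
    filter_upwards [hψ.tendsto_atTop.eventually (hsmall M ρ hρ)] with n hn u hu
    exact hmem _ u ρ (hKD hu)
      ((mul_le_mul_of_nonneg_left (hM u hu) (hr _).le).trans_lt hn)

lemma RescalingsConverge.mono {g : ℂ → OnePoint ℂ} {S T : Set ℂ} {v : ℕ → ℂ} {r : ℕ → ℝ}
    {h : ℂ → OnePoint ℂ} {D : Set ℂ} (hS : RescalingsConverge g S v r h D) (hST : S ⊆ T) :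
    RescalingsConverge g T v r h D := fun K hKD hK =>
  ⟨(hS K hKD hK).1.mono fun _ hn z hz => hST (hn z hz), (hS K hKD hK).2⟩

end SphereValued

theorem mainTheorem3 (v : ℂ) (W : Set ℂ) (hWclosed : IsClosed W) (hWnhds : W ∈ 𝓝 v)
    (g : ℂ → OnePoint ℂ) (hg : SphereValued.HolomorphicOn g (W \ {v}))
    (hess : SphereValued.HasEssentialSingularityAt g v) :
    (∃ (vs : ℕ → ℂ) (r : ℕ → ℝ) (h : ℂ → OnePoint ℂ),
      Tendsto vs atTop (𝓝 v) ∧ (∀ n, 0 < r n) ∧ Tendsto r atTop (𝓝 0) ∧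
      SphereValued.HolomorphicOn h Set.univ ∧ ¬ SphereValued.IsConstantOn h Set.univ ∧
      SphereValued.RescalingsConverge g (W \ {v}) vs r h Set.univ) ∨
    (∃ (ζ : ℂ) (vs : ℕ → ℂ) (r : ℕ → ℝ) (h : ℂ → OnePoint ℂ),
      Tendsto vs atTop (𝓝 v) ∧ (∀ n, 0 < r n) ∧ Tendsto r atTop (𝓝 0) ∧
      SphereValued.HolomorphicOn h {ζ}ᶜ ∧ ¬ SphereValued.IsConstantOn h {ζ}ᶜ ∧
      SphereValued.RescalingsConverge g (W \ {v}) vs r h {ζ}ᶜ) := by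
  obtain ⟨ρ, hρ, hρW⟩ := Metric.mem_nhds_iff.1 hWnhds
  have hsub : Metric.ball v ρ \ {v} ⊆ W \ {v} := Set.sdiff_subset_sdiff_left hρW
  have hat := (SphereValued.holomorphicOn_iff_of_isOpen
    (Metric.isOpen_ball.sdiff isClosed_singleton)).1 (hg.mono hsub)
  by_cases hunb : ∀ C : ℝ, ∀ δ > 0, ∃ z ∈ Metric.ball v δ \ {v},
      C < dist z v * SphereValued.sphericalDeriv g z
  · obtain ⟨vs, r, h, h1, h2, h3, h4, h5, h6⟩ :=
      SphereValued.exists_rescaling_limit_univ hρ hat hunb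
    exact Or.inl ⟨vs, r, h, h1, h2, h3, h4, h5, h6.mono hsub⟩
  · push Not at hunb
    obtain ⟨C, δ, hδ, hbd⟩ := hunb
    obtain ⟨r, h, h1, h2, h3, h4, h5⟩ :=
      SphereValued.exists_rescaling_limit_punctured hρ hat hess hδ hbd
    exact Or.inr ⟨0, fun _ => v, r, h, tendsto_const_nhds, h1, h2, h3, h4, h5.mono hsub⟩
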